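/- Let $1<p<\infty$ and let $(X,d,\mu)$ be a complete metric space with a doubling Borel measure $\mu$ that supports a $p$-Poincaré inequality. Let $\Omega\subset X$ be a bounded domain (non-empty, connected, open) with $\mu(X\setminus\Omega)>0$ that is of finite perimeter, with perimeter measure $P_\Omega$ (the Carathéodory extension of the perimeter of $\Omega$ in open sets). Assume that there is a constant $C\ge 1$ such that for all $x\in\partial\Omega$, $z\in\Omega$ and $0<r\le\operatorname{diam}(\Omega)$, $$\mu(B(z,r)\cap\Omega)\ge C^{-1}\mu(B(z,r)),\qquad C^{-1}\frac{\mu(B(x,r))}{r}\le P_\Omega(B(x,r))\le C\,\frac{\mu(B(x,r))}{r},$$ and that $(\Omega,d|_\Omega,\mu\lfloor_\Omega)$ supports a $p$-Poincaré inequality with dilation factor $1$. Let $f:\partial\Omega\to\mathbb R$ be a bounded $P_\Omega$-measurable function with $\int_{\partial\Omega}f\,dP_\Omega=0$. For $u:\Omega\to\mathbb R$ in the Newtonian space $N^{1,p}(\Omega)$ let $g_u$ be its minimal $p$-weak upper gradient in $\Omega$, let $Tu$ be its trace, determined at $P_\Omega$-a.e. $x\in\partial\Omega$ by $$\lim_{r\to0^+}\frac{1}{\mu(B(x,r)\cap\Omega)}\int_{B(x,r)\cap\Omega}|u-Tu(x)|\,d\mu=0,$$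 and let $$I(u)=\int_\Omega g_u^p\,d\mu+\int_{\partial\Omega}Tu\,f\,dP_\Omega .$$ Let $N^{1,p}_*(\Omega)=\{u\in N^{1,p}(\Omega):\int_\Omega u\,d\mu=0\}$, and let $M_I$ be the set of the $u\in N^{1,p}_*(\Omega)$ with $I(u)\le I(v)$ for all $v\in N^{1,p}_*(\Omega)$. Suppose that $u,v\in M_I$. Then $Tu\,f$ and $Tv\,f$ are $P_\Omega$-integrable on $\partial\Omega$ with $$\int_{\partial\Omega}Tu\,f\,dP_\Omega=\int_{\partial\Omega}Tv\,f\,dP_\Omega,$$ the minimal $p$-weak upper gradients $g_u$, $g_v$ exist, and $g_u=g_v$ $\mu$-a.e. in $\Omega$. Furthermore, the functions $$w_+=\max\{u,v\}-\frac1{\mu(\Omega)}\int_\Omega\max\{u,v\}\,d\mu,\qquad w_-=\min\{u,v\}-\frac1{\mu(\Omega)}\int_\Omega\min\{u,v\}\,d\mu$$ also belong to $M_I$. -/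

import Mathlib

open Set Filter Topology MeasureTheory
open scoped NNReal ENNReal

noncomputable section

namespace NeumannMetric

/-! ### Curves, upper gradients, modulus -/

/-- A non-constant compact rectifiable curve in `X`, parametrized by arc length on `[0, len]`:
the length of the piece of the curve over `[s, t] ⊆ [0, len]` is `t - s`. (Such a curve is
`1`-Lipschitz on `[0, len]`; only the values on `[0, len]` matter. Each non-constant rectifiable
curve has such a parametrization, and its end points and line integrals are read off from it.) -/
structure ArcCurve (X : Type*) [MetricSpace X] where
  len : ℝ
  len_pos : 0 < len
  toFun : ℝ → X
  unitSpeed : HasUnitSpeedOn toFun (Icc 0 len)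

section Curves

variable {X : Type*} [MetricSpace X]

/-- The curve `γ` runs inside the set `Ω`. -/
def ArcCurve.In (γ : ArcCurve X) (Ω : Set X) : Prop :=
  ∀ t ∈ Icc 0 γ.len, γ.toFun t ∈ Ω

/-- The line integral `∫_γ g ds`. -/
def ArcCurve.lineIntegral (γ : ArcCurve X) (g : X → ℝ≥0∞) : ℝ≥0∞ :=
  ∫⁻ t in Icc 0 γ.len, g (γ.toFun t)

/-- The upper gradient inequality `|u(y) - u(x)| ≤ ∫_γ g ds` on the curve `γ` from `x` to `y`. -/
def UGIneq (u : X → ℝ) (g : X → ℝ≥0∞) (γ : ArcCurve X) : Prop :=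
  edist (u (γ.toFun γ.len)) (u (γ.toFun 0)) ≤ γ.lineIntegral g

end Curves

variable {X : Type*} [MetricSpace X] [MeasurableSpace X]

/-- The Borel function `g` is an upper gradient of `u` in `Ω`. Functions on `Ω` are written as
functions on `X` of which only the values in `Ω` are used. -/
def IsUpperGradient (Ω : Set X) (u : X → ℝ) (g : X → ℝ≥0∞) : Prop :=
  Measurable g ∧ ∀ γ : ArcCurve X, γ.In Ω → UGIneq u g γ

/-- The `p`-modulus, in the space `Ω`, of a family `Γ` of curves in `Ω`. -/
def modulus (μ : Measure X) (p : ℝ) (Ω : Set X) (Γ : Set (ArcCurve X)) : ℝ≥0∞ :=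
  ⨅ (ρ : X → ℝ≥0∞) (_ : Measurable ρ ∧ ∀ γ ∈ Γ, 1 ≤ γ.lineIntegral ρ),
    ∫⁻ x in Ω, ρ x ^ p ∂μ

/-- The Borel function `g` is a `p`-weak upper gradient of `u` in `Ω`: the upper gradient
inequality holds on all curves in `Ω` outside a family of vanishing `p`-modulus. -/
def IsWeakUpperGradient (μ : Measure X) (p : ℝ) (Ω : Set X) (u : X → ℝ) (g : X → ℝ≥0∞) : Prop :=
  Measurable g ∧ modulus μ p Ω {γ | γ.In Ω ∧ ¬ UGIneq u g γ} = 0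

/-- `g` is a minimal `p`-weak upper gradient of `u` in `Ω`: it is a `p`-weak upper gradient
in `L^p(Ω)` that is a.e. at most any other one. -/
def IsMinimalWeakUpperGradient (μ : Measure X) (p : ℝ) (Ω : Set X) (u : X → ℝ)
    (g : X → ℝ≥0∞) : Prop :=
  IsWeakUpperGradient μ p Ω u g ∧ ∫⁻ x in Ω, g x ^ p ∂μ < ∞ ∧
    ∀ h : X → ℝ≥0∞, IsWeakUpperGradient μ p Ω u h → ∫⁻ x in Ω, h x ^ p ∂μ < ∞ →
      g ≤ᵐ[μ.restrict Ω] h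

open Classical in
/-- The minimal `p`-weak upper gradient `g_u` of `u` in `Ω` (unique up to null sets). -/
def minGrad (μ : Measure X) (p : ℝ) (Ω : Set X) (u : X → ℝ) : X → ℝ≥0∞ :=
  if h : ∃ g, IsMinimalWeakUpperGradient μ p Ω u g then h.choose else fun _ => ∞

/-- The Newtonian space `N^{1,p}(Ω)` of the metric measure space `(Ω, d|_Ω, μ⌊_Ω)`. -/
def Newtonian (μ : Measure X) (p : ℝ) (Ω : Set X) : Set (X → ℝ) :=
  {u | MemLp u (ENNReal.ofReal p) (μ.restrict Ω) ∧
    ∃ g, IsUpperGradient Ω u g ∧ ∫⁻ x in Ω, g x ^ p ∂μ < ∞}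

/-! ### Doubling measures and Poincaré inequalities -/

/-- The measure `μ` is doubling. -/
def IsDoubling (μ : Measure X) : Prop :=
  ∃ C : ℝ≥0, ∀ (x : X) (r : ℝ), 0 < r →
    0 < μ (Metric.ball x r) ∧ μ (Metric.ball x r) < ∞ ∧
    μ (Metric.ball x (2 * r)) ≤ C * μ (Metric.ball x r)

/-- The metric measure space `(Ω, d|_Ω, μ⌊_Ω)` supports a `p`-Poincaré inequality with dilation
factor `lam`. The balls of this space are the sets `B(x, r) ∩ Ω` with `x ∈ Ω`; the functions `u`
are those integrable on bounded subsets of `Ω`, and `g` is any upper gradient of `u` in `Ω`. -/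
def SupportsPoincare (μ : Measure X) (p : ℝ) (Ω : Set X) (lam : ℝ) : Prop :=
  ∃ C : ℝ≥0, 0 < C ∧ ∀ (u : X → ℝ) (g : X → ℝ≥0∞),
    (∀ A ⊆ Ω, MeasurableSet A → Bornology.IsBounded A → IntegrableOn u A μ) →
    IsUpperGradient Ω u g → ∀ x ∈ Ω, ∀ r : ℝ, 0 < r →
      ⨍⁻ y in Metric.ball x r ∩ Ω, ‖u y - ⨍ z in Metric.ball x r ∩ Ω, u z ∂μ‖ₑ ∂μ ≤
        C * ENNReal.ofReal r * (⨍⁻ y in Metric.ball x (lam * r) ∩ Ω, g y ^ p ∂μ) ^ (1 / p)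

/-! ### The perimeter measure -/

/-- `(u_k, g_k)` is an admissible sequence for the perimeter of `E` in `U`: `u_k ∈ N^{1,1}(U)`
with upper gradients `g_k` in `U`, and `u_k → χ_{E ∩ U}` in `L^1(U)`. -/
def PerimeterAdmissible (μ : Measure X) (E U : Set X) (u : ℕ → X → ℝ) (g : ℕ → X → ℝ≥0∞) : Prop :=
  (∀ k, u k ∈ Newtonian μ 1 U ∧ IsUpperGradient U (u k) (g k)) ∧
    Tendsto (fun k => ∫⁻ x in U, ‖u k x - E.indicator (fun _ => (1 : ℝ)) x‖ₑ ∂μ) atTop (𝓝 0)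

/-- The perimeter of `E` in the open set `U`. The infimum runs over the functions `u_k` and over
their upper gradients `g_k`; as `∫_U g_{u_k} dμ` for the minimal `1`-weak upper gradient is the
infimum of `∫_U g dμ` over all upper gradients of `u_k`, this is the infimum of
`liminf ∫_U g_{u_k} dμ` over all sequences `u_k → χ_{E ∩ U}`. -/
def perimeter (μ : Measure X) (E U : Set X) : ℝ≥0∞ :=
  ⨅ (u : ℕ → X → ℝ) (g : ℕ → X → ℝ≥0∞) (_ : PerimeterAdmissible μ E U u g),
    liminf (fun k => ∫⁻ x in U, g k x ∂μ) atTop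

theorem IsUpperGradient.mono {U W : Set X} {u : X → ℝ} {g : X → ℝ≥0∞} (hUW : U ⊆ W)
    (h : IsUpperGradient W u g) : IsUpperGradient U u g :=
  ⟨h.1, fun γ hγ => h.2 γ fun t ht => hUW (hγ t ht)⟩

theorem Newtonian.mono {μ : Measure X} {p : ℝ} {U W : Set X} (hUW : U ⊆ W) :
    Newtonian μ p W ⊆ Newtonian μ p U := by
  rintro u ⟨hu, g, hg, hg'⟩
  exact ⟨hu.mono_measure (Measure.restrict_mono hUW le_rfl), g, hg.mono hUW,
    (lintegral_mono_set hUW).trans_lt hg'⟩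

theorem PerimeterAdmissible.mono {μ : Measure X} {E U W : Set X} {u : ℕ → X → ℝ}
    {g : ℕ → X → ℝ≥0∞} (hUW : U ⊆ W) (h : PerimeterAdmissible μ E W u g) :
    PerimeterAdmissible μ E U u g :=
  ⟨fun k => ⟨Newtonian.mono hUW (h.1 k).1, (h.1 k).2.mono hUW⟩,
    tendsto_of_tendsto_of_tendsto_of_le_of_le tendsto_const_nhds h.2 (fun _ => zero_le)
      fun _ => lintegral_mono_set hUW⟩

theorem perimeter_empty (μ : Measure X) (E : Set X) : perimeter μ E ∅ = 0 := by
  have hg : IsUpperGradient (∅ : Set X) (fun _ => (0 : ℝ)) (fun _ => 0) :=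
    ⟨measurable_const, fun γ _ => by simp [UGIneq]⟩
  have h : PerimeterAdmissible μ E ∅ (fun _ _ => 0) (fun _ _ => 0) :=
    ⟨fun k => ⟨⟨MemLp.zero', fun _ => 0, hg, by simp⟩, hg⟩, by
      simp only [Measure.restrict_empty, lintegral_zero_measure]
      exact tendsto_const_nhds⟩
  refine le_antisymm ?_ zero_le
  refine iInf_le_of_le _ (iInf_le_of_le _ (iInf_le_of_le h ?_))
  simp only [lintegral_zero, liminf_const, le_refl]

theorem perimeter_add_le (μ : Measure X) (E : Set X) {U V W : Set X} (hV : MeasurableSet V)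
    (hUW : U ⊆ W) (hVW : V ⊆ W) (hd : Disjoint U V) :
    perimeter μ E U + perimeter μ E V ≤ perimeter μ E W := by
  refine le_iInf fun u => le_iInf fun g => le_iInf fun h => ?_
  have hU : perimeter μ E U ≤ liminf (fun k => ∫⁻ x in U, g k x ∂μ) atTop :=
    iInf_le_of_le u (iInf_le_of_le g (iInf_le_of_le (h.mono hUW) le_rfl))
  have hV' : perimeter μ E V ≤ liminf (fun k => ∫⁻ x in V, g k x ∂μ) atTop :=
    iInf_le_of_le u (iInf_le_of_le g (iInf_le_of_le (h.mono hVW) le_rfl))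
  refine (add_le_add hU hV').trans (le_trans (b := liminf
    ((fun k => ∫⁻ x in U, g k x ∂μ) + fun k => ∫⁻ x in V, g k x ∂μ) atTop) ?_
    (liminf_le_liminf ?_))
  · simp only [liminf_eq_iSup_iInf_of_nat]
    rw [ENNReal.iSup_add_iSup_of_monotone
      (fun _ _ hab => biInf_mono fun _ hi => le_trans hab hi)
      (fun _ _ hab => biInf_mono fun _ hi => le_trans hab hi)]
    exact iSup_mono fun n => le_iInf₂ fun k hk =>
      add_le_add (iInf₂_le k hk) (iInf₂_le k hk)
  refine Eventually.of_forall fun k => ?_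
  simp only [Pi.add_apply]
  rw [← lintegral_union hV hd]
  exact lintegral_mono_set (union_subset hUW hVW)

/-- The outer measure generated by the perimeter of `E` in open sets:
`A ↦ inf {∑ perimeter of E in U_i : U_i open, A ⊆ ⋃ U_i}`. -/
def perimeterOuter (μ : Measure X) (E : Set X) : OuterMeasure X :=
  inducedOuterMeasure (fun (U : Set X) (_ : IsOpen U) => perimeter μ E U) isOpen_empty
    (perimeter_empty μ E)

theorem perimeterOuter_isMetric [BorelSpace X] (μ : Measure X) (E : Set X) :
    (perimeterOuter μ E).IsMetric := by
  rintro s t ⟨r, hr, hst⟩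
  refine le_antisymm (measure_union_le s t) ?_
  have hr2 : 0 < r / 2 := ENNReal.half_pos hr
  set S : Set X := ⋃ x ∈ s, Metric.eball x (r / 2)
  set T : Set X := ⋃ x ∈ t, Metric.eball x (r / 2)
  have hS : IsOpen S := isOpen_biUnion fun _ _ => Metric.isOpen_eball
  have hT : IsOpen T := isOpen_biUnion fun _ _ => Metric.isOpen_eball
  have hsS : s ⊆ S := fun x hx => mem_biUnion hx (Metric.mem_eball_self hr2)
  have htT : t ⊆ T := fun x hx => mem_biUnion hx (Metric.mem_eball_self hr2)
  have hd : Disjoint S T := by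
    rw [Set.disjoint_left]
    intro z hz hz'
    obtain ⟨x, hx, hzx⟩ := mem_iUnion₂.1 hz
    obtain ⟨y, hy, hzy⟩ := mem_iUnion₂.1 hz'
    rw [Metric.mem_eball] at hzx hzy
    have h1 := hst x hx y hy
    have h2 : edist x y < r / 2 + r / 2 :=
      (edist_triangle_left x y z).trans_lt (ENNReal.add_lt_add hzx hzy)
    rw [ENNReal.add_halves] at h2
    exact absurd h1 (not_le.2 h2)
  have key : ∀ (c : Set X) (O : Set X), IsOpen O → perimeterOuter μ E (c ∩ O) ≤
      extend (fun (U : Set X) (_ : IsOpen U) => perimeter μ E U) (c ∩ O) := fun c O _ =>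
    OuterMeasure.ofFunction_le (m_empty := extend_empty isOpen_empty (perimeter_empty μ E)) _
  conv_rhs => rw [perimeterOuter, inducedOuterMeasure, OuterMeasure.ofFunction_apply]
  refine le_iInf fun c => le_iInf fun hc => ?_
  have hs' : perimeterOuter μ E s ≤ ∑' i, perimeterOuter μ E (c i ∩ S) := by
    refine le_trans (measure_mono ?_) (measure_iUnion_le _)
    rw [← iUnion_inter]
    exact subset_inter (subset_union_left.trans hc) hsS
  have ht' : perimeterOuter μ E t ≤ ∑' i, perimeterOuter μ E (c i ∩ T) := by
    refine le_trans (measure_mono ?_) (measure_iUnion_le _)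
    rw [← iUnion_inter]
    exact subset_inter (subset_union_right.trans hc) htT
  refine (add_le_add hs' ht').trans ?_
  rw [← ENNReal.tsum_add]
  refine ENNReal.tsum_le_tsum fun i => ?_
  by_cases hi : IsOpen (c i)
  · refine (add_le_add (key _ S hS) (key _ T hT)).trans ?_
    rw [extend_eq _ (hi.inter hS), extend_eq _ (hi.inter hT), extend_eq _ hi]
    exact perimeter_add_le μ E (hi.inter hT).measurableSet inter_subset_left inter_subset_left
      (hd.mono inter_subset_right inter_subset_right)
  · simp [extend, hi]

/-- The perimeter measure `P_E`: the Carathéodory extension of the perimeter of `E` in open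
sets, as a Borel measure. -/
def perimeterMeasure [BorelSpace X] (μ : Measure X) (E : Set X) : Measure X :=
  (perimeterOuter μ E).toMeasure (perimeterOuter_isMetric μ E).le_caratheodory

/-! ### Traces and the Neumann functional -/

/-- `t` is the trace of `u` at the boundary point `x`: the mean of `|u - t|` over `B(x, r) ∩ Ω`
tends to `0` as `r → 0+`. -/
def HasTraceAt (μ : Measure X) (Ω : Set X) (u : X → ℝ) (x : X) (t : ℝ) : Prop :=
  Tendsto (fun r : ℝ => ⨍⁻ y in Metric.ball x r ∩ Ω, ‖u y - t‖ₑ ∂μ) (𝓝[>] 0) (𝓝 0)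

open Classical in
/-- The trace `Tu` of `u` (set to `0` at the points where there is no trace). -/
def trace (μ : Measure X) (Ω : Set X) (u : X → ℝ) (x : X) : ℝ :=
  if h : ∃ t, HasTraceAt μ Ω u x t then h.choose else 0

/-- The boundary term `∫_{∂Ω} Tu f dP_Ω`. -/
def boundaryTerm [BorelSpace X] (μ : Measure X) (Ω : Set X) (f u : X → ℝ) : ℝ :=
  ∫ x in frontier Ω, trace μ Ω u x * f x ∂(perimeterMeasure μ Ω)

/-- The functional `I(u) = ∫_Ω g_u^p dμ + ∫_{∂Ω} Tu f dP_Ω`. -/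
def neumannFunctional [BorelSpace X] (μ : Measure X) (p : ℝ) (Ω : Set X) (f u : X → ℝ) : ℝ :=
  (∫⁻ x in Ω, minGrad μ p Ω u x ^ p ∂μ).toReal + boundaryTerm μ Ω f u

/-- The class `N^{1,p}_*(Ω)` of the `u ∈ N^{1,p}(Ω)` with `∫_Ω u dμ = 0`. -/
def NewtonianZero (μ : Measure X) (p : ℝ) (Ω : Set X) : Set (X → ℝ) :=
  {u | u ∈ Newtonian μ p Ω ∧ ∫ x in Ω, u x ∂μ = 0}

/-- The set `M_I` of the minimizers of `I` over `N^{1,p}_*(Ω)`. -/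
def minimizers [BorelSpace X] (μ : Measure X) (p : ℝ) (Ω : Set X) (f : X → ℝ) : Set (X → ℝ) :=
  {u | u ∈ NewtonianZero μ p Ω ∧
    ∀ v ∈ NewtonianZero μ p Ω, neumannFunctional μ p Ω f u ≤ neumannFunctional μ p Ω f v}

/-- The standing assumptions on the domain: `Ω` is a bounded domain with complement of positive
measure and of finite perimeter, it has the measure density property, its perimeter measure is
Ahlfors codimension `1` regular, and `Ω` supports a `p`-Poincaré inequality with dilation
factor `1`. -/
structure AdmissibleDomain [BorelSpace X] (μ : Measure X) (p : ℝ) (Ω : Set X) : Prop where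
  isOpen : IsOpen Ω
  isConnected : IsConnected Ω
  isBounded : Bornology.IsBounded Ω
  compl_pos : 0 < μ Ωᶜ
  finite_perimeter : perimeter μ Ω univ < ∞
  regular : ∃ C : ℝ≥0, 1 ≤ C ∧ ∀ r : ℝ, 0 < r → r ≤ Metric.diam Ω →
    (∀ z ∈ Ω, μ (Metric.ball z r) ≤ C * μ (Metric.ball z r ∩ Ω)) ∧
    ∀ x ∈ frontier Ω,
      μ (Metric.ball x r) / ENNReal.ofReal r ≤ C * perimeterMeasure μ Ω (Metric.ball x r) ∧
      perimeterMeasure μ Ω (Metric.ball x r) ≤ C * (μ (Metric.ball x r) / ENNReal.ofReal r)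
  poincare : SupportsPoincare μ p Ω 1

/-- Boundary data: a bounded `P_Ω`-measurable function on `∂Ω` with vanishing integral. -/
structure BoundaryData [BorelSpace X] (μ : Measure X) (Ω : Set X) (f : X → ℝ) : Prop where
  measurable : AEMeasurable f ((perimeterMeasure μ Ω).restrict (frontier Ω))
  bounded : ∃ M : ℝ, ∀ x ∈ frontier Ω, |f x| ≤ M
  integral_eq_zero : ∫ x in frontier Ω, f x ∂(perimeterMeasure μ Ω) = 0

end NeumannMetric

end

open NeumannMetric

/-! The argument is the direct one for a strictly convex energy plus a linear boundary term. Both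
minimizers have the same value of I. The midpoint (u+v)/2 is admissible, its boundary term is the
mean of the two boundary terms, and (g_u+g_v)/2 is a p-weak upper gradient of it. Minimality
therefore forces the energy of (g_u+g_v)/2 to be at least the mean of the two energies. Strict
convexity of t ↦ t^p then gives g_u = g_v a.e., hence equal energies and equal boundary terms.

For max and min: both have max(g_u, g_v) = g_u as a weak upper gradient, so their energies do not
exceed that of u. Subtracting the mean changes neither this bound nor the boundary term, since ∫ f
dP_Ω = 0. As max + min = u + v holds for the traces, the boundary terms of w_+ and w_- add up to
twice that of u. Thus I(w_+) + I(w_-) ≤ 2 I(u), while each summand is at least I(u), so both are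
minimizers.

Two facts carry this. One is the existence of minimal weak upper gradients
(`exists_isMinimalWeakUpperGradient`): weak upper gradients in L^p are stable under minima and
decreasing limits, by absolute continuity along curves and Fuglede's description of families of
modulus zero. The other is that Newtonian functions have an integrable trace P_Ω-a.e.
(`AdmissibleDomain.trace_theorem`), by telescoping averages over dyadic balls. Once traces exist
a.e., they commute with Lipschitz combinations (`AdmissibleDomain.trace_comp_lipschitz`). -/

noncomputable section

namespace NeumannMetric

/-! ### Functions on an interval dominated by integrals -/

section Interval

variable {φ : ℝ → ℝ} {a b : ℝ → ℝ≥0∞} {L : ℝ}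

/-- The hypothesis bounds increments of φ by increments of a primitive of `a`. The form symmetric in
s and t serves both absolute continuity and the comparison of difference quotients. -/
theorem dist_le_integral_toReal (ha : Measurable a)
    (ha' : ∫⁻ t in Icc 0 L, a t ≠ ∞)
    (h : ∀ s t, 0 ≤ s → s ≤ t → t ≤ L → edist (φ t) (φ s) ≤ ∫⁻ x in Icc s t, a x)
    {s t : ℝ} (hs : s ∈ Icc 0 L) (ht : t ∈ Icc 0 L) :
    dist (φ s) (φ t) ≤ dist (∫ x in 0..s, (a x).toReal) (∫ x in 0..t, (a x).toReal) := by
  have hint : IntegrableOn (fun x => (a x).toReal) (Icc 0 L) :=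
    integrable_toReal_of_lintegral_ne_top ha.aemeasurable ha'
  have hii : ∀ x ∈ Icc 0 L, ∀ y ∈ Icc 0 L,
      IntervalIntegrable (fun x => (a x).toReal) volume x y := fun x hx y hy =>
    (hint.mono_set (uIcc_subset_Icc hx hy)).intervalIntegrable
  wlog hst : s ≤ t generalizing s t
  · rw [dist_comm, dist_comm (∫ x in 0..s, _)]
    exact this ht hs (le_of_not_ge hst)
  have h0 : (0 : ℝ) ∈ Icc 0 L := ⟨le_rfl, hs.1.trans hs.2⟩
  have hfin : ∫⁻ x in Icc s t, a x ≠ ∞ :=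
    ((lintegral_mono_set (Icc_subset_Icc hs.1 ht.2)).trans_lt ha'.lt_top).ne
  rw [dist_comm, dist_comm (∫ x in 0..s, _), Real.dist_eq (∫ x in 0..t, _),
    intervalIntegral.integral_interval_sub_left (hii _ h0 _ ht) (hii _ h0 _ hs),
    intervalIntegral.integral_of_le hst, ← integral_Icc_eq_integral_Ioc,
    integral_toReal ha.aemeasurable (ae_lt_top ha hfin)]
  refine (le_trans ?_ (le_abs_self _))
  rw [dist_edist]
  exact ENNReal.toReal_mono hfin (h s t hs.1 hst ht.2)

theorem absolutelyContinuousOnInterval_of_edist_le (hL : 0 ≤ L) (ha : Measurable a)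
    (ha' : ∫⁻ t in Icc 0 L, a t ≠ ∞)
    (h : ∀ s t, 0 ≤ s → s ≤ t → t ≤ L → edist (φ t) (φ s) ≤ ∫⁻ x in Icc s t, a x) :
    AbsolutelyContinuousOnInterval φ 0 L := by
  have hint : IntegrableOn (fun x => (a x).toReal) (uIcc 0 L) := by
    rw [uIcc_of_le hL]
    exact integrable_toReal_of_lintegral_ne_top ha.aemeasurable ha'
  have hA := hint.intervalIntegrable.absolutelyContinuousOnInterval_intervalIntegral
    (c := 0) left_mem_uIcc
  rw [absolutelyContinuousOnInterval_iff] at hA ⊢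
  intro ε hε
  obtain ⟨δ, hδ, hδ'⟩ := hA ε hε
  refine ⟨δ, hδ, fun E hE hE' => lt_of_le_of_lt (Finset.sum_le_sum fun i hi => ?_) (hδ' E hE hE')⟩
  have := hE.1 i hi
  rw [uIcc_of_le hL] at this
  exact dist_le_integral_toReal ha ha' h this.1 this.2

/-- At almost every point both φ and the primitive of `a` are differentiable. The slopes of φ are
dominated by those of the primitive, whose derivative is `a`. -/
theorem enorm_deriv_le_of_edist_le (hL : 0 ≤ L) (ha : Measurable a)
    (ha' : ∫⁻ t in Icc 0 L, a t ≠ ∞)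
    (h : ∀ s t, 0 ≤ s → s ≤ t → t ≤ L → edist (φ t) (φ s) ≤ ∫⁻ x in Icc s t, a x) :
    ∀ᵐ x ∂volume.restrict (Ioc 0 L), ‖deriv φ x‖ₑ ≤ a x := by
  have hint : IntegrableOn (fun x => (a x).toReal) (uIcc 0 L) := by
    rw [uIcc_of_le hL]
    exact integrable_toReal_of_lintegral_ne_top ha.aemeasurable ha'
  rw [← restrict_Ioo_eq_restrict_Ioc]
  rw [ae_restrict_iff' measurableSet_Ioo]
  filter_upwards [(absolutelyContinuousOnInterval_of_edist_le hL ha ha' h).ae_differentiableAt,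
    hint.intervalIntegrable.ae_hasDerivAt_integral] with x h1 h2 hx
  have hxI : x ∈ uIcc 0 L := by rw [uIcc_of_le hL]; exact Ioo_subset_Icc_self hx
  have d1 := hasDerivAt_iff_tendsto_slope.1 (h1 hxI).hasDerivAt
  have d2 := hasDerivAt_iff_tendsto_slope.1 (h2 hxI 0 left_mem_uIcc)
  have hle : |deriv φ x| ≤ |(a x).toReal| := by
    refine le_of_tendsto_of_tendsto d1.abs d2.abs ?_
    have : ∀ᶠ y in 𝓝[≠] x, y ∈ Icc 0 L :=
      nhdsWithin_le_nhds (Icc_mem_nhds hx.1 hx.2)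
    filter_upwards [this] with y hy
    simp only [slope_def_field, abs_div]
    exact div_le_div_of_nonneg_right
      (dist_le_integral_toReal ha ha' h hy (Ioo_subset_Icc_self hx)) (abs_nonneg _)
  rw [abs_of_nonneg ENNReal.toReal_nonneg] at hle
  rw [Real.enorm_eq_ofReal_abs]
  exact (ENNReal.ofReal_le_ofReal hle).trans ENNReal.ofReal_toReal_le

/-- Absolute continuity turns the two integral bounds into pointwise bounds on |φ'|, where the
minimum can be taken; integrating φ' returns to increments. -/
theorem edist_le_lintegral_min (hL : 0 ≤ L) (ha : Measurable a) (hb : Measurable b)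
    (ha' : ∫⁻ t in Icc 0 L, a t ≠ ∞) (hb' : ∫⁻ t in Icc 0 L, b t ≠ ∞)
    (hφa : ∀ s t, 0 ≤ s → s ≤ t → t ≤ L → edist (φ t) (φ s) ≤ ∫⁻ x in Icc s t, a x)
    (hφb : ∀ s t, 0 ≤ s → s ≤ t → t ≤ L → edist (φ t) (φ s) ≤ ∫⁻ x in Icc s t, b x) :
    edist (φ L) (φ 0) ≤ ∫⁻ x in Icc 0 L, min (a x) (b x) := by
  have hac := absolutelyContinuousOnInterval_of_edist_le hL ha ha' hφa
  rw [edist_eq_enorm_sub, ← hac.integral_deriv_eq_sub, intervalIntegral.integral_of_le hL,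
    ← restrict_Ioc_eq_restrict_Icc]
  refine (enorm_integral_le_lintegral_enorm _).trans (lintegral_mono_ae ?_)
  filter_upwards [enorm_deriv_le_of_edist_le hL ha ha' hφa,
    enorm_deriv_le_of_edist_le hL hb hb' hφb] with x h1 h2 using le_min h1 h2

end Interval

/-! ### Curves and their pieces -/

section Curves

variable {X : Type*} [MetricSpace X]

theorem ArcCurve.continuousOn (γ : ArcCurve X) : ContinuousOn γ.toFun (Icc 0 γ.len) := by
  have : LipschitzOnWith 1 γ.toFun (Icc 0 γ.len) := by
    intro x hx y hy
    wlog hxy : x ≤ y generalizing x y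
    · rw [edist_comm, edist_comm x]
      exact this hy hx (le_of_not_ge hxy)
    have h := γ.unitSpeed hx hy
    have h2 := eVariationOn.edist_le γ.toFun (s := Icc 0 γ.len ∩ Icc x y)
      ⟨hx, left_mem_Icc.2 hxy⟩ ⟨hy, right_mem_Icc.2 hxy⟩
    rw [h] at h2
    refine h2.trans ?_
    rw [edist_comm, edist_dist, Real.dist_eq, abs_of_nonneg (sub_nonneg.2 hxy)]
    simp
  exact this.continuousOn

/-- The continuous extension of the curve `γ` to `ℝ`, constant outside of `[0, len]`. -/
def ArcCurve.extend (γ : ArcCurve X) (t : ℝ) : X :=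
  γ.toFun (projIcc 0 γ.len γ.len_pos.le t)

theorem ArcCurve.continuous_extend (γ : ArcCurve X) : Continuous γ.extend :=
  (continuousOn_iff_continuous_domRestrict.1 γ.continuousOn).comp continuous_projIcc

theorem ArcCurve.extend_of_mem (γ : ArcCurve X) {t : ℝ} (ht : t ∈ Icc 0 γ.len) :
    γ.extend t = γ.toFun t := by
  rw [ArcCurve.extend, projIcc_of_mem γ.len_pos.le ht]

theorem ArcCurve.lineIntegral_eq_extend (γ : ArcCurve X) (g : X → ℝ≥0∞) :
    γ.lineIntegral g = ∫⁻ t in Icc 0 γ.len, g (γ.extend t) :=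
  setLIntegral_congr_fun measurableSet_Icc fun t ht => by
    simp only [γ.extend_of_mem ht]

theorem ArcCurve.lineIntegral_mono (γ : ArcCurve X) {g h : X → ℝ≥0∞} (hgh : ∀ x, g x ≤ h x) :
    γ.lineIntegral g ≤ γ.lineIntegral h :=
  lintegral_mono fun _ => hgh _

/-- The piece of the curve `γ` over `[s, t]`. -/
def ArcCurve.piece (γ : ArcCurve X) (s t : ℝ) (hs : 0 ≤ s) (hst : s < t) (ht : t ≤ γ.len) :
    ArcCurve X where
  len := t - s
  len_pos := sub_pos.2 hst
  toFun x := γ.toFun (s + x)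
  unitSpeed := by
    intro x hx y hy
    have h := γ.unitSpeed (x := s + x) ⟨by linarith [hx.1], by linarith [hx.2]⟩
      (y := s + y) ⟨by linarith [hy.1], by linarith [hy.2]⟩
    have h2 := eVariationOn.comp_eq_of_monotoneOn γ.toFun (t := Icc 0 (t - s) ∩ Icc x y)
      (fun x => s + x) (fun _ _ _ _ h => by simpa using h)
    have h3 : (fun x => s + x) '' (Icc 0 (t - s) ∩ Icc x y)
        = Icc 0 γ.len ∩ Icc (s + x) (s + y) := by
      rw [Icc_inter_Icc, image_const_add_Icc, Icc_inter_Icc]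
      congr 1 <;> simp only [max_eq_right hx.1, min_eq_right hy.2]
      · rw [max_eq_right]; linarith [hx.1]
      · rw [min_eq_right]; linarith [hy.2]
    change eVariationOn (γ.toFun ∘ fun x => s + x) _ = _
    rw [h2, h3, h]
    congr 2
    ring

theorem ArcCurve.In.piece {γ : ArcCurve X} {Ω : Set X} (h : γ.In Ω) {s t : ℝ} (hs : 0 ≤ s)
    (hst : s < t) (ht : t ≤ γ.len) : (γ.piece s t hs hst ht).In Ω := fun x hx =>
  h _ ⟨by linarith [hx.1], by have := hx.2; simp only [ArcCurve.piece] at this; linarith⟩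

theorem ArcCurve.lineIntegral_piece (γ : ArcCurve X) (g : X → ℝ≥0∞) {s t : ℝ} (hs : 0 ≤ s)
    (hst : s < t) (ht : t ≤ γ.len) :
    (γ.piece s t hs hst ht).lineIntegral g = ∫⁻ x in Icc s t, g (γ.toFun x) := by
  have h := (measurePreserving_add_left (volume : Measure ℝ) s).setLIntegral_comp_preimage_emb
    (MeasurableEquiv.addLeft s).measurableEmbedding (fun x => g (γ.toFun x)) (Icc s t)
  rw [preimage_const_add_Icc, sub_self] at h
  exact h

theorem ArcCurve.lineIntegral_piece_le (γ : ArcCurve X) (g : X → ℝ≥0∞) {s t : ℝ} (hs : 0 ≤ s)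
    (hst : s < t) (ht : t ≤ γ.len) :
    (γ.piece s t hs hst ht).lineIntegral g ≤ γ.lineIntegral g := by
  rw [γ.lineIntegral_piece]
  exact lintegral_mono_set (Icc_subset_Icc hs ht)

end Curves

/-! ### Families of curves of vanishing modulus -/

section LpBounds

variable {X : Type*} [MeasurableSpace X] {μ : Measure X} {p : ℝ} {Ω : Set X}

/-- The pointwise ℓ^p norm of the sequence dominates each term, and its p-th power integrates to the
given sum. -/
theorem exists_dominating_of_tsum_lt_top (hp : 0 < p) {ρ : ℕ → X → ℝ≥0∞}
    (hρ : ∀ n, Measurable (ρ n)) (hsum : ∑' n, ∫⁻ x in Ω, ρ n x ^ p ∂μ < ∞) :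
    ∃ σ : X → ℝ≥0∞, Measurable σ ∧ ∫⁻ x in Ω, σ x ^ p ∂μ < ∞ ∧ ∀ n x, ρ n x ≤ σ x := by
  refine ⟨fun x => (∑' n, ρ n x ^ p) ^ (1 / p),
    (Measurable.tsum fun n => (hρ n).pow_const p).pow_const _, ?_, fun n x => ?_⟩
  · simp only [← ENNReal.rpow_mul, one_div, inv_mul_cancel₀ hp.ne', ENNReal.rpow_one]
    rwa [lintegral_tsum fun n => ((hρ n).pow_const p).aemeasurable]
  · calc ρ n x = (ρ n x ^ p) ^ (1 / p) := by
          rw [← ENNReal.rpow_mul, mul_one_div_cancel hp.ne', ENNReal.rpow_one]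
      _ ≤ _ := ENNReal.rpow_le_rpow (ENNReal.le_tsum n) (by positivity)

theorem lintegral_const_mul_rpow (hp : 0 < p) {c : ℝ≥0∞} (hc : c ≠ ∞) (ρ : X → ℝ≥0∞) :
    ∫⁻ x in Ω, (c * ρ x) ^ p ∂μ = c ^ p * ∫⁻ x in Ω, ρ x ^ p ∂μ := by
  simp only [ENNReal.mul_rpow_of_nonneg _ _ hp.le]
  exact lintegral_const_mul' _ _ (ENNReal.rpow_ne_top_of_nonneg hp.le hc)

theorem lintegral_max_rpow_lt_top {ρ σ : X → ℝ≥0∞} (hρ : Measurable ρ)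
    (hρ' : ∫⁻ x in Ω, ρ x ^ p ∂μ < ∞) (hσ' : ∫⁻ x in Ω, σ x ^ p ∂μ < ∞) :
    ∫⁻ x in Ω, max (ρ x) (σ x) ^ p ∂μ < ∞ := by
  refine (lintegral_mono (g := fun x => ρ x ^ p + σ x ^ p) fun x => ?_).trans_lt ?_
  · rcases le_total (ρ x) (σ x) with h | h
    · simp [max_eq_right h]
    · simp [max_eq_left h]
  · rw [lintegral_add_left (hρ.pow_const p)]
    exact ENNReal.add_lt_top.2 ⟨hρ', hσ'⟩

end LpBounds

theorem ArcCurve.lineIntegral_const_mul {X : Type*} [MetricSpace X] (γ : ArcCurve X) {c : ℝ≥0∞} (hc : c ≠ ∞) (g : X → ℝ≥0∞) :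
    γ.lineIntegral (fun x => c * g x) = c * γ.lineIntegral g :=
  lintegral_const_mul' _ _ hc

section Modulus

variable {X : Type*} [MetricSpace X] [MeasurableSpace X] {μ : Measure X} {p : ℝ} {Ω : Set X}

theorem exists_lintegral_rpow_lt_of_modulus_eq_zero {Γ : Set (ArcCurve X)}
    (h : modulus μ p Ω Γ = 0) {ε : ℝ≥0∞} (hε : 0 < ε) :
    ∃ ρ : X → ℝ≥0∞, Measurable ρ ∧ ∫⁻ x in Ω, ρ x ^ p ∂μ < ε ∧ ∀ γ ∈ Γ, 1 ≤ γ.lineIntegral ρ := by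
  rw [← h, modulus] at hε
  obtain ⟨ρ, hρ⟩ := iInf_lt_iff.1 hε
  obtain ⟨hρ', hρ''⟩ := iInf_lt_iff.1 hρ
  exact ⟨ρ, hρ'.1, hρ'', hρ'.2⟩

/-- Fuglede's criterion. Densities of summable energy giving the curves length at least n are merged
into a single one; conversely, small multiples of a density of infinite length are still admissible.
-/
theorem modulus_eq_zero_iff (hp : 0 < p) {Γ : Set (ArcCurve X)} :
    modulus μ p Ω Γ = 0 ↔ ∃ ρ : X → ℝ≥0∞, Measurable ρ ∧ ∫⁻ x in Ω, ρ x ^ p ∂μ < ∞ ∧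
      ∀ γ ∈ Γ, γ.lineIntegral ρ = ∞ := by
  constructor
  · intro h
    obtain ⟨ε, hε, hε'⟩ := ENNReal.exists_pos_sum_of_countable' one_ne_zero ℕ
    have key : ∀ n : ℕ, ∃ ρ : X → ℝ≥0∞, Measurable ρ ∧ ∫⁻ x in Ω, ρ x ^ p ∂μ < ε n ∧
        ∀ γ ∈ Γ, (n : ℝ≥0∞) ≤ γ.lineIntegral ρ := by
      intro n
      have hn0 : ((n : ℝ≥0∞) + 1) ≠ 0 := by simp
      have hnt : ((n : ℝ≥0∞) + 1) ≠ ∞ := by finiteness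
      have hp0 : ((n : ℝ≥0∞) + 1) ^ p ≠ 0 := by
        rw [Ne, ENNReal.rpow_eq_zero_iff]; simp [hn0, hnt]
      have hpt : ((n : ℝ≥0∞) + 1) ^ p ≠ ∞ := ENNReal.rpow_ne_top_of_nonneg hp.le hnt
      -- The divisor compensates the factor (n+1)^p that the energy gains when the density is
      -- multiplied by n+1.
      obtain ⟨ρ, hρ, hρ1, hρ2⟩ := exists_lintegral_rpow_lt_of_modulus_eq_zero h
        (ε := ε n / ((n : ℝ≥0∞) + 1) ^ p) (ENNReal.div_pos (hε n).ne' hpt)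
      refine ⟨fun x => ((n : ℝ≥0∞) + 1) * ρ x, hρ.const_mul _, ?_, fun γ hγ => ?_⟩
      · rw [lintegral_const_mul_rpow hp hnt, mul_comm]
        exact (ENNReal.lt_div_iff_mul_lt (Or.inl hp0) (Or.inl hpt)).1 hρ1
      · rw [γ.lineIntegral_const_mul hnt]
        calc (n : ℝ≥0∞) ≤ ((n : ℝ≥0∞) + 1) * 1 := by simp
          _ ≤ _ := by gcongr; exact hρ2 γ hγ
    choose ρ h1 h2 h3 using key
    obtain ⟨σ, hσ, hσ', hσ''⟩ := exists_dominating_of_tsum_lt_top (μ := μ) (Ω := Ω) hp h1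
      (((ENNReal.tsum_le_tsum fun n => (h2 n).le).trans_lt hε').trans ENNReal.one_lt_top)
    refine ⟨σ, hσ, hσ', fun γ hγ => ENNReal.eq_top_of_forall_nnreal_le fun r => ?_⟩
    obtain ⟨n, hn⟩ := exists_nat_ge r
    calc (r : ℝ≥0∞) ≤ n := by exact_mod_cast hn
      _ ≤ _ := (h3 n γ hγ).trans (γ.lineIntegral_mono (hσ'' n))
  · rintro ⟨ρ, hρ, hρ', h⟩
    refine le_antisymm (ENNReal.le_of_forall_pos_le_add fun ε hε _ => ?_) zero_le
    rw [zero_add]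
    set K := ∫⁻ x in Ω, ρ x ^ p ∂μ
    -- The scaling factor δ^(1/p) multiplies the energy K by δ. Dividing by K + 1 instead of K
    -- covers K = 0.
    set δ : ℝ≥0∞ := ε / (K + 1)
    have hK : K + 1 ≠ ∞ := by finiteness
    have hδ0 : δ ≠ 0 := (ENNReal.div_pos (by exact_mod_cast hε.ne') hK).ne'
    have hδt : δ ≠ ∞ := ENNReal.div_ne_top (by finiteness) (by simp)
    have hct : δ ^ (1 / p) ≠ ∞ := ENNReal.rpow_ne_top_of_nonneg (by positivity) hδt
    have hc0 : δ ^ (1 / p) ≠ 0 := by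
      rw [Ne, ENNReal.rpow_eq_zero_iff]; simp [hδ0, hδt]
    refine (iInf₂_le (fun x => δ ^ (1 / p) * ρ x) ⟨hρ.const_mul _, fun γ hγ => ?_⟩).trans ?_
    · rw [lintegral_const_mul_rpow hp hct, ← ENNReal.rpow_mul, one_div_mul_cancel hp.ne',
        ENNReal.rpow_one]
      calc δ * K ≤ δ * (K + 1) := by gcongr; exact le_self_add
        _ = ε := ENNReal.div_mul_cancel (by simp) hK
    · rw [γ.lineIntegral_const_mul hct, h γ hγ, ENNReal.mul_top hc0]
      exact le_top

/-- The weak upper gradients of `u` are the Borel functions that satisfy the upper gradient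
inequality on all curves of finite `ρ`-length, for some `ρ ∈ L^p(Ω)`. -/
theorem isWeakUpperGradient_iff (hp : 0 < p) {u : X → ℝ} {g : X → ℝ≥0∞} :
    IsWeakUpperGradient μ p Ω u g ↔ Measurable g ∧ ∃ ρ : X → ℝ≥0∞, Measurable ρ ∧
      ∫⁻ x in Ω, ρ x ^ p ∂μ < ∞ ∧
      ∀ γ : ArcCurve X, γ.In Ω → γ.lineIntegral ρ ≠ ∞ → UGIneq u g γ := by
  rw [IsWeakUpperGradient, modulus_eq_zero_iff hp]
  refine and_congr_right fun _ => exists_congr fun ρ => and_congr_right fun _ =>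
    and_congr_right fun _ => ⟨fun h γ hγ hρ => ?_, fun h γ hγ => ?_⟩
  · by_contra hu
    exact hρ (h γ ⟨hγ, hu⟩)
  · by_contra hρ
    exact hγ.2 (h γ hγ.1 hρ)

theorem IsUpperGradient.isWeakUpperGradient (hp : 0 < p) {u : X → ℝ} {g : X → ℝ≥0∞}
    (h : IsUpperGradient Ω u g) : IsWeakUpperGradient μ p Ω u g :=
  (isWeakUpperGradient_iff hp).2 ⟨h.1, fun _ => 0, measurable_const,
    by simp [hp], fun γ hγ _ => h.2 γ hγ⟩

/-- A Borel function that satisfies the upper gradient inequality for `w` on the curves on which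
two weak upper gradients satisfy those for `u` and `v` is a weak upper gradient of `w`. -/
theorem IsWeakUpperGradient.combine (hp : 0 < p) {u v w : X → ℝ} {g h k : X → ℝ≥0∞}
    (hg : IsWeakUpperGradient μ p Ω u g) (hh : IsWeakUpperGradient μ p Ω v h) (hk : Measurable k)
    (hw : ∀ γ : ArcCurve X, UGIneq u g γ → UGIneq v h γ → UGIneq w k γ) :
    IsWeakUpperGradient μ p Ω w k := by
  rw [isWeakUpperGradient_iff hp] at hg hh ⊢
  obtain ⟨_, ρ, hρ, hρ', hρ''⟩ := hg
  obtain ⟨_, σ, hσ, hσ', hσ''⟩ := hh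
  refine ⟨hk, fun x => max (ρ x) (σ x), hρ.max hσ, lintegral_max_rpow_lt_top hρ hρ' hσ',
    fun γ hγ hfin => hw γ (hρ'' γ hγ ?_) (hσ'' γ hγ ?_)⟩
  · exact ((γ.lineIntegral_mono fun x => le_max_left (ρ x) (σ x)).trans_lt hfin.lt_top).ne
  · exact ((γ.lineIntegral_mono fun x => le_max_right (ρ x) (σ x)).trans_lt hfin.lt_top).ne

/-! ### Minima, decreasing limits and minimal elements of the weak upper gradients -/

variable [BorelSpace X]

/-- The upper gradient inequality for a minimum, on a curve all of whose pieces satisfy it. -/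
theorem UGIneq.min_of_pieces {u : X → ℝ} {g h : X → ℝ≥0∞} {γ : ArcCurve X}
    (hg : Measurable g) (hh : Measurable h)
    (hgγ : γ.lineIntegral g ≠ ∞) (hhγ : γ.lineIntegral h ≠ ∞)
    (hg' : ∀ s t hs hst ht, UGIneq u g (γ.piece s t hs hst ht))
    (hh' : ∀ s t hs hst ht, UGIneq u h (γ.piece s t hs hst ht)) :
    UGIneq u (fun x => min (g x) (h x)) γ := by
  have key : ∀ k : X → ℝ≥0∞, (∀ s t hs hst ht, UGIneq u k (γ.piece s t hs hst ht)) →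
      ∀ s t, 0 ≤ s → s ≤ t → t ≤ γ.len → edist (u (γ.extend t)) (u (γ.extend s)) ≤
        ∫⁻ x in Icc s t, k (γ.extend x) := by
    intro k hk s t hs hst ht
    rcases hst.eq_or_lt with rfl | hlt
    · simp
    have h1 := hk s t hs hlt ht
    rw [UGIneq, γ.lineIntegral_piece] at h1
    simp only [ArcCurve.piece, add_zero, add_sub_cancel] at h1
    rw [γ.extend_of_mem ⟨hs.trans hst, ht⟩, γ.extend_of_mem ⟨hs, hst.trans ht⟩]
    refine h1.trans_eq (setLIntegral_congr_fun measurableSet_Icc fun x hx => ?_)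
    simp only [γ.extend_of_mem ⟨hs.trans hx.1, hx.2.trans ht⟩]
  rw [γ.lineIntegral_eq_extend] at hgγ hhγ
  have := edist_le_lintegral_min (φ := fun t => u (γ.extend t)) γ.len_pos.le
    (hg.comp γ.continuous_extend.measurable) (hh.comp γ.continuous_extend.measurable) hgγ hhγ
    (key g hg') (key h hh')
  rw [UGIneq, γ.lineIntegral_eq_extend, ← γ.extend_of_mem (right_mem_Icc.2 γ.len_pos.le),
    ← γ.extend_of_mem (left_mem_Icc.2 γ.len_pos.le)]
  exact this

/-- Finite length with respect to a density passes to pieces of a curve. Off one exceptional family,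
all pieces thus satisfy both upper gradient inequalities. -/
theorem IsWeakUpperGradient.minimum (hp : 0 < p) {u : X → ℝ} {g h : X → ℝ≥0∞}
    (hg : IsWeakUpperGradient μ p Ω u g) (hh : IsWeakUpperGradient μ p Ω u h)
    (hgp : ∫⁻ x in Ω, g x ^ p ∂μ < ∞) (hhp : ∫⁻ x in Ω, h x ^ p ∂μ < ∞) :
    IsWeakUpperGradient μ p Ω u (fun x => min (g x) (h x)) := by
  rw [isWeakUpperGradient_iff hp] at hg hh ⊢
  obtain ⟨hgm, ρ, hρ, hρ', hρ''⟩ := hg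
  obtain ⟨hhm, σ, hσ, hσ', hσ''⟩ := hh
  -- Including g and h in the density makes their line integrals finite, as absolute continuity
  -- along the curve requires.
  refine ⟨hgm.min hhm, fun x => max (max (g x) (h x)) (max (ρ x) (σ x)),
    (hgm.max hhm).max (hρ.max hσ), lintegral_max_rpow_lt_top (hgm.max hhm)
      (lintegral_max_rpow_lt_top hgm hgp hhp) (lintegral_max_rpow_lt_top hρ hρ' hσ'),
    fun γ hγ hfin => ?_⟩
  have hle : ∀ k : X → ℝ≥0∞, (∀ x, k x ≤ max (max (g x) (h x)) (max (ρ x) (σ x))) →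
      γ.lineIntegral k ≠ ∞ := fun k hk => ((γ.lineIntegral_mono hk).trans_lt hfin.lt_top).ne
  refine UGIneq.min_of_pieces hgm hhm (hle g fun x => by simp) (hle h fun x => by simp)
    (fun s t hs hst ht => hρ'' _ (hγ.piece hs hst ht) ?_)
    (fun s t hs hst ht => hσ'' _ (hγ.piece hs hst ht) ?_)
  · exact ((γ.lineIntegral_piece_le ρ hs hst ht).trans_lt (hle ρ fun x => by simp).lt_top).ne
  · exact ((γ.lineIntegral_piece_le σ hs hst ht).trans_lt (hle σ fun x => by simp).lt_top).ne

/-- The countably many exceptional densities are rescaled to summable energies and merged; on the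
remaining curves monotone convergence passes the inequality to the infimum. -/
theorem IsWeakUpperGradient.infimum (hp : 0 < p) {u : X → ℝ} {g : ℕ → X → ℝ≥0∞}
    (hg : ∀ n, IsWeakUpperGradient μ p Ω u (g n)) (hanti : ∀ n x, g (n + 1) x ≤ g n x)
    (hgp : ∫⁻ x in Ω, g 0 x ^ p ∂μ < ∞) :
    IsWeakUpperGradient μ p Ω u (fun x => ⨅ n, g n x) := by
  obtain ⟨ε, hε, hε'⟩ := ENNReal.exists_pos_sum_of_countable' one_ne_zero ℕ
  have key : ∀ n, ∃ ρ : X → ℝ≥0∞, Measurable ρ ∧ ∫⁻ x in Ω, ρ x ^ p ∂μ ≤ ε n ∧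
      ∀ γ : ArcCurve X, γ.In Ω → γ.lineIntegral ρ ≠ ∞ → UGIneq u (g n) γ := by
    intro n
    obtain ⟨_, ρ, hρ, hρ', hρ''⟩ := (isWeakUpperGradient_iff hp).1 (hg n)
    set K := ∫⁻ x in Ω, ρ x ^ p ∂μ
    set δ : ℝ≥0∞ := min 1 (ε n / (K + 1))
    have hK : K + 1 ≠ ∞ := by finiteness
    have hδ0 : δ ≠ 0 := (lt_min one_pos (ENNReal.div_pos (hε n).ne' hK)).ne'
    have hδt : δ ≠ ∞ := ((min_le_left _ _).trans_lt ENNReal.one_lt_top).ne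
    have hct : δ ^ (1 / p) ≠ ∞ := ENNReal.rpow_ne_top_of_nonneg (by positivity) hδt
    have hc0 : δ ^ (1 / p) ≠ 0 := by
      rw [Ne, ENNReal.rpow_eq_zero_iff]; simp [hδ0, hδt]
    refine ⟨fun x => δ ^ (1 / p) * ρ x, hρ.const_mul _, ?_, fun γ hγ hfin => hρ'' γ hγ ?_⟩
    · rw [lintegral_const_mul_rpow hp hct, ← ENNReal.rpow_mul, one_div_mul_cancel hp.ne',
        ENNReal.rpow_one]
      calc δ * K ≤ ε n / (K + 1) * (K + 1) := by
            gcongr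
            · exact min_le_right _ _
            · exact le_self_add
        _ = ε n := ENNReal.div_mul_cancel (by simp) hK
    · intro htop
      rw [γ.lineIntegral_const_mul hct, htop, ENNReal.mul_top hc0] at hfin
      exact hfin rfl
  choose ρ h1 h2 h3 using key
  obtain ⟨σ, hσ, hσ', hσ''⟩ := exists_dominating_of_tsum_lt_top (μ := μ) (Ω := Ω) hp h1
    (((ENNReal.tsum_le_tsum h2).trans_lt hε').trans ENNReal.one_lt_top)
  refine (isWeakUpperGradient_iff hp).2 ⟨Measurable.iInf fun n => (hg n).1,
    -- Monotone convergence for decreasing functions needs the first line integral to be finite,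
    -- hence the term `g 0`.
    fun x => max (g 0 x) (σ x), (hg 0).1.max hσ,
    lintegral_max_rpow_lt_top (hg 0).1 hgp hσ', fun γ hγ hfin => ?_⟩
  have hle : ∀ k : X → ℝ≥0∞, (∀ x, k x ≤ max (g 0 x) (σ x)) →
      γ.lineIntegral k ≠ ∞ := fun k hk => ((γ.lineIntegral_mono hk).trans_lt hfin.lt_top).ne
  have h0 := hle (g 0) fun x => le_max_left _ _
  rw [γ.lineIntegral_eq_extend] at h0
  rw [UGIneq, γ.lineIntegral_eq_extend,
    lintegral_iInf_ae (f := fun n t => g n (γ.extend t))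
      (fun n => (hg n).1.comp γ.continuous_extend.measurable)
      (fun n => ae_of_all _ fun t => hanti n _) h0]
  refine le_iInf fun n => ?_
  rw [← γ.lineIntegral_eq_extend]
  exact h3 n γ hγ (hle _ fun x => (hσ'' n x).trans (le_max_right _ _))

/-- A function with a weak upper gradient in `L^p` has a minimal one. -/
theorem exists_isMinimalWeakUpperGradient (hp : 0 < p) {u : X → ℝ}
    (hu : ∃ g, IsWeakUpperGradient μ p Ω u g ∧ ∫⁻ x in Ω, g x ^ p ∂μ < ∞) :
    ∃ g, IsMinimalWeakUpperGradient μ p Ω u g := by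
  set S : Set (X → ℝ≥0∞) := {g | IsWeakUpperGradient μ p Ω u g ∧ ∫⁻ x in Ω, g x ^ p ∂μ < ∞}
  have hmin : ∀ g ∈ S, ∀ h ∈ S, (fun x => min (g x) (h x)) ∈ S := fun g hg h hh =>
    ⟨hg.1.minimum hp hh.1 hg.2 hh.2, (lintegral_mono fun x =>
      ENNReal.rpow_le_rpow (min_le_left _ _) hp.le).trans_lt hg.2⟩
  set J : (X → ℝ≥0∞) → ℝ≥0∞ := fun g => ∫⁻ x in Ω, g x ^ p ∂μ
  have hne : (J '' S).Nonempty := hu.imp' J fun g hg => ⟨g, hg, rfl⟩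
  obtain ⟨a, -, ha, haS⟩ := exists_seq_tendsto_sInf hne (OrderBot.bddBelow _)
  choose h hhS hh using haS
  -- Running minima make the minimizing sequence decreasing without leaving S.
  set g : ℕ → X → ℝ≥0∞ := fun n => Nat.rec (h 0) (fun n k x => min (k x) (h (n + 1) x)) n
  have hgS : ∀ n, g n ∈ S := fun n => by
    induction n with
    | zero => exact hhS 0
    | succ n ih => exact hmin _ ih _ (hhS (n + 1))
  have hgle : ∀ n x, g n x ≤ h n x := fun n x => by
    cases n with
    | zero => exact le_rfl
    | succ n => exact min_le_right _ _
  have hanti : ∀ n x, g (n + 1) x ≤ g n x := fun n x => min_le_left _ _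
  set k : X → ℝ≥0∞ := fun x => ⨅ n, g n x
  have hkJ : ∀ n, J k ≤ J (h n) := fun n => lintegral_mono fun x =>
    ENNReal.rpow_le_rpow ((iInf_le _ n).trans (hgle n x)) hp.le
  have hkW : IsWeakUpperGradient μ p Ω u k :=
    IsWeakUpperGradient.infimum hp (fun n => (hgS n).1) hanti (hgS 0).2
  have hkfin : J k < ∞ := (hkJ 0).trans_lt (hhS 0).2
  refine ⟨k, hkW, hkfin, fun f hf hf' => ?_⟩
  have hkinf : J k ≤ sInf (J '' S) := ge_of_tendsto' ha fun n => (hkJ n).trans_eq (hh n)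
  -- The competitor min(k, f) lies below k but cannot have smaller energy, so it equals k a.e.,
  -- which means k ≤ f a.e.
  have hmS := hmin k ⟨hkW, hkfin⟩ f ⟨hf, hf'⟩
  have hle : J k ≤ J (fun x => min (k x) (f x)) := hkinf.trans (sInf_le ⟨_, hmS, rfl⟩)
  have hae := ae_eq_of_ae_le_of_lintegral_le (μ := μ.restrict Ω)
    (f := fun x => min (k x) (f x) ^ p) (g := fun x => k x ^ p)
    (ae_of_all _ fun x => ENNReal.rpow_le_rpow (min_le_left _ _) hp.le) hmS.2.ne
    (hkW.1.pow_const p).aemeasurable hle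
  filter_upwards [hae] with x hx
  have := ENNReal.rpow_left_injective hp.ne' hx
  exact min_eq_left_iff.1 this

theorem Newtonian.isMinimalWeakUpperGradient_minGrad (hp : 0 < p) {u : X → ℝ}
    (hu : u ∈ Newtonian μ p Ω) : IsMinimalWeakUpperGradient μ p Ω u (minGrad μ p Ω u) := by
  obtain ⟨-, g, hg, hg'⟩ := hu
  have h := exists_isMinimalWeakUpperGradient hp ⟨g, hg.isWeakUpperGradient (μ := μ) hp, hg'⟩
  rw [minGrad, dif_pos h]
  exact h.choose_spec

end Modulus

/-! ### Averages -/

section Averages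

variable {α : Type*} [MeasurableSpace α] {μ : Measure α} {A B : Set α}

theorem setLAverage_le_mul_of_subset {K : ℝ≥0∞} (hK : K ≠ ∞) (hA : μ A ≠ 0)
    (hAB : A ⊆ B) (hB : μ B ≤ K * μ A) (h : α → ℝ≥0∞) :
    ⨍⁻ x in A, h x ∂μ ≤ K * ⨍⁻ x in B, h x ∂μ := by
  have hK0 : K ≠ 0 := by
    rintro rfl
    exact hA (le_antisymm (((measure_mono hAB).trans hB).trans_eq (zero_mul _)) zero_le)
  have hinv : (μ A)⁻¹ ≤ K * (μ B)⁻¹ :=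
    calc (μ A)⁻¹ = K * (K * μ A)⁻¹ := by
          rw [ENNReal.mul_inv (Or.inl hK0) (Or.inl hK), ← mul_assoc, ENNReal.mul_inv_cancel hK0 hK,
            one_mul]
      _ ≤ K * (μ B)⁻¹ := by gcongr
  rw [setLAverage_eq, setLAverage_eq, ENNReal.div_eq_inv_mul, ENNReal.div_eq_inv_mul, ← mul_assoc]
  exact mul_le_mul' hinv (lintegral_mono_set hAB)

theorem enorm_setAverage_sub_le (hA : μ A ≠ 0) (hA' : μ A ≠ ∞) {u : α → ℝ}
    (hu : IntegrableOn u A μ) (c : ℝ) :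
    ‖(⨍ x in A, u x ∂μ) - c‖ₑ ≤ ⨍⁻ x in A, ‖u x - c‖ₑ ∂μ := by
  have h1 : (⨍ x in A, u x ∂μ) - c = (μ.real A)⁻¹ * ∫ x in A, (u x - c) ∂μ := by
    have : IntegrableOn (fun _ => c) A μ := integrableOn_const hA'
    rw [integral_sub hu this, setAverage_eq, smul_eq_mul, setIntegral_const, smul_eq_mul, mul_sub,
      ← mul_assoc, inv_mul_cancel₀ (measureReal_ne_zero_iff hA' |>.2 hA), one_mul]
  have h2 : ‖(μ.real A)⁻¹‖ₑ = (μ A)⁻¹ := by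
    rw [Real.enorm_eq_ofReal (by positivity), Measure.real,
      ENNReal.ofReal_inv_of_pos (ENNReal.toReal_pos hA hA'), ENNReal.ofReal_toReal hA']
  rw [h1, enorm_mul, h2, setLAverage_eq, ENNReal.div_eq_inv_mul]
  gcongr
  exact enorm_integral_le_lintegral_enorm _

theorem setLAverage_enorm_sub_le (hA : μ A ≠ 0) (hA' : μ A ≠ ∞) (u : α → ℝ) (c d : ℝ) :
    ⨍⁻ x in A, ‖u x - d‖ₑ ∂μ ≤ (⨍⁻ x in A, ‖u x - c‖ₑ ∂μ) + ‖c - d‖ₑ := by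
  rw [← setLAverage_const hA hA' ‖c - d‖ₑ, setLAverage_eq, setLAverage_eq, setLAverage_eq,
    ← ENNReal.add_div, ← lintegral_add_right _ measurable_const]
  gcongr with x
  calc ‖u x - d‖ₑ = ‖(u x - c) + (c - d)‖ₑ := by ring_nf
    _ ≤ _ := enorm_add_le _ _

end Averages

/-! ### Traces -/

section Trace

variable {X : Type*} [MetricSpace X] [MeasurableSpace X] {μ : Measure X} {Ω : Set X}
  {u v : X → ℝ} {x : X} {s t : ℝ}

/-- The constant |s − t| is at most the sum of the two mean deviations, which tends to 0. Uniqueness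
makes the chosen value in `trace` computable. -/
theorem HasTraceAt.eq (hpos : ∀ r > 0, μ (Metric.ball x r ∩ Ω) ≠ 0)
    (hfin : ∀ r, μ (Metric.ball x r ∩ Ω) ≠ ∞)
    (hu : ∀ r, AEMeasurable u (μ.restrict (Metric.ball x r ∩ Ω)))
    (hs : HasTraceAt μ Ω u x s) (ht : HasTraceAt μ Ω u x t) : s = t := by
  have h := hs.add ht
  rw [add_zero] at h
  have hle : ‖s - t‖ₑ ≤ 0 := by
    refine ge_of_tendsto h ?_
    filter_upwards [self_mem_nhdsWithin] with r hr
    rw [← setLAverage_const (hpos r hr) (hfin r) ‖s - t‖ₑ, setLAverage_eq, setLAverage_eq,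
      setLAverage_eq, ← ENNReal.add_div, ← lintegral_add_left' ((hu r).sub_const s).enorm]
    gcongr with y
    calc ‖s - t‖ₑ = ‖(u y - t) - (u y - s)‖ₑ := by ring_nf
      _ ≤ ‖u y - t‖ₑ + ‖u y - s‖ₑ := enorm_sub_le
      _ = _ := add_comm _ _
  simpa [sub_eq_zero] using hle

theorem HasTraceAt.trace_eq (hpos : ∀ r > 0, μ (Metric.ball x r ∩ Ω) ≠ 0)
    (hfin : ∀ r, μ (Metric.ball x r ∩ Ω) ≠ ∞)
    (hu : ∀ r, AEMeasurable u (μ.restrict (Metric.ball x r ∩ Ω)))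
    (ht : HasTraceAt μ Ω u x t) : trace μ Ω u x = t := by
  have h : ∃ t, HasTraceAt μ Ω u x t := ⟨t, ht⟩
  rw [trace, dif_pos h]
  exact HasTraceAt.eq hpos hfin hu h.choose_spec ht

/-- A function that is dominated by two functions up to their traces has a trace. -/
theorem HasTraceAt.of_enorm_sub_le {w : X → ℝ} {t' : ℝ}
    (hu : ∀ r, AEMeasurable u (μ.restrict (Metric.ball x r ∩ Ω)))
    (hs : HasTraceAt μ Ω u x s) (ht : HasTraceAt μ Ω v x t)
    (h : ∀ y, ‖w y - t'‖ₑ ≤ ‖u y - s‖ₑ + ‖v y - t‖ₑ) : HasTraceAt μ Ω w x t' := by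
  have h0 := hs.add ht
  rw [add_zero] at h0
  refine tendsto_of_tendsto_of_tendsto_of_le_of_le tendsto_const_nhds h0 (fun _ => zero_le)
    fun r => ?_
  simp only [setLAverage_eq]
  rw [← ENNReal.add_div, ← lintegral_add_left' ((hu r).sub_const s).enorm]
  gcongr with y
  exact h y

/-- The trace exists at the points where the mean oscillations over dyadic balls are summable. -/
theorem exists_hasTraceAt_of_tsum_ne_top {R : ℝ} (hR : 0 < R) {K : ℝ≥0∞} (hK : K ≠ ∞)
    (hpos : ∀ r > 0, μ (Metric.ball x r ∩ Ω) ≠ 0) (hfin : ∀ r, μ (Metric.ball x r ∩ Ω) ≠ ∞)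
    (hdbl : ∀ k : ℕ, μ (Metric.ball x (R * (1 / 2) ^ k) ∩ Ω) ≤
      K * μ (Metric.ball x (R * (1 / 2) ^ (k + 1)) ∩ Ω))
    (hu : IntegrableOn u Ω μ) {d : ℕ → ℝ≥0∞}
    (hd : ∀ k : ℕ, ⨍⁻ y in Metric.ball x (R * (1 / 2) ^ k) ∩ Ω,
      ‖u y - ⨍ z in Metric.ball x (R * (1 / 2) ^ k) ∩ Ω, u z ∂μ‖ₑ ∂μ ≤ d k)
    (hsum : ∑' k, d k ≠ ∞) :
    ∃ t, Tendsto (fun k : ℕ => ⨍ z in Metric.ball x (R * (1 / 2) ^ k) ∩ Ω, u z ∂μ) atTop (𝓝 t) ∧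
      HasTraceAt μ Ω u x t ∧
      ‖(⨍ z in Metric.ball x R ∩ Ω, u z ∂μ) - t‖ₑ ≤ K * ∑' k, d k := by
  set ρ : ℕ → ℝ := fun k => R * (1 / 2) ^ k
  have hρ : ∀ k, 0 < ρ k := fun k => by positivity
  set m : ℕ → ℝ := fun k => ⨍ z in Metric.ball x (ρ k) ∩ Ω, u z ∂μ
  have hρle : ∀ k, ρ (k + 1) ≤ ρ k := fun k => by
    simp only [ρ, pow_succ]
    have : 0 < R * (1 / 2) ^ k := by positivity
    linarith
  have hsub : ∀ r s : ℝ, r ≤ s → Metric.ball x r ∩ Ω ⊆ Metric.ball x s ∩ Ω := fun r s h =>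
    inter_subset_inter_left _ (Metric.ball_subset_ball h)
  -- Consecutive means differ by at most the oscillation on the larger ball, up to the doubling
  -- factor K; summability makes them a Cauchy sequence.
  have hstep : ∀ k, edist (m k) (m (k + 1)) ≤ K * d k := fun k => by
    rw [edist_comm, edist_eq_enorm_sub]
    refine (enorm_setAverage_sub_le (hpos _ (hρ _)) (hfin _) (hu.mono_set inter_subset_right)
      _).trans ?_
    refine (setLAverage_le_mul_of_subset hK (hpos _ (hρ _)) (hsub _ _ (hρle k))
      (hdbl k) _).trans ?_
    gcongr
    exact hd k
  have hsum' : ∑' k, K * d k ≠ ∞ := by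
    rw [ENNReal.tsum_mul_left]
    exact ENNReal.mul_ne_top hK hsum
  obtain ⟨t, ht⟩ := cauchySeq_tendsto_of_complete (cauchySeq_of_edist_le_of_tsum_ne_top _ hstep hsum')
  refine ⟨t, ht, ?_, ?_⟩
  · have hlim : Tendsto (fun k => K * (d k + ‖m k - t‖ₑ)) atTop (𝓝 0) := by
      have h1 : Tendsto (fun k => ‖m k - t‖ₑ) atTop (𝓝 0) := by
        simpa [edist_eq_enorm_sub] using tendsto_iff_edist_tendsto_0.1 ht
      have h2 := (ENNReal.tendsto_atTop_zero_of_tsum_ne_top hsum).add h1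
      simpa using ENNReal.Tendsto.const_mul h2 (Or.inr hK)
    rw [HasTraceAt, ENNReal.tendsto_nhds_zero]
    intro ε hε
    obtain ⟨N, hN⟩ := eventually_atTop.1 (ENNReal.tendsto_nhds_zero.1 hlim ε hε)
    filter_upwards [Ioo_mem_nhdsGT (hρ N)] with r hr
    -- An arbitrary small r is placed between consecutive dyadic radii, ρ (k+1) < r ≤ ρ k, at the
    -- cost of one factor K.
    obtain ⟨k, hk1, hk2⟩ := exists_nat_pow_near_of_lt_one (x := r / R) (y := 1 / 2)
      (div_pos hr.1 hR) ((div_le_one hR).2 (hr.2.le.trans (by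
        simp only [ρ]
        exact mul_le_of_le_one_right hR.le (pow_le_one₀ (by norm_num) (by norm_num)))))
      (by norm_num) (by norm_num)
    rw [lt_div_iff₀' hR] at hk1
    rw [div_le_iff₀' hR] at hk2
    have hNk : N ≤ k := by
      by_contra hlt
      have : ρ N ≤ ρ (k + 1) := by
        simp only [ρ]
        exact mul_le_mul_of_nonneg_left
          (pow_le_pow_of_le_one (by norm_num) (by norm_num) (by omega)) hR.le
      exact absurd (hk1.trans hr.2) (not_lt.2 this)
    refine le_trans ?_ (hN k hNk)
    refine (setLAverage_le_mul_of_subset hK (hpos _ hr.1) (hsub _ _ hk2)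
      ((hdbl k).trans (by gcongr)) _).trans ?_
    gcongr
    exact (setLAverage_enorm_sub_le (hpos _ (hρ _)) (hfin _) u (m k) t).trans
      (by gcongr; exact hd k)
  · have h := edist_le_tsum_of_edist_le_of_tendsto₀ _ hstep ht
    rw [ENNReal.tsum_mul_left, edist_eq_enorm_sub] at h
    simpa [m, ρ] using h

end Trace

/-! ### Doubling measures -/

section Doubling

variable {X : Type*} [MetricSpace X] [MeasurableSpace X] {μ : Measure X}

theorem IsDoubling.sigmaFinite (hμ : IsDoubling μ) : SigmaFinite μ := by
  obtain ⟨C, hC⟩ := hμ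
  rcases isEmpty_or_nonempty X with h | ⟨⟨x⟩⟩
  · rw [Measure.eq_zero_of_isEmpty μ]
    infer_instance
  · refine ⟨⟨⟨fun n : ℕ => Metric.ball x (n + 1), fun _ => trivial,
      fun n => (hC x _ (by positivity)).2.1, eq_univ_of_forall fun y => mem_iUnion.2 ?_⟩⟩⟩
    obtain ⟨n, hn⟩ := exists_nat_gt (dist y x)
    exact ⟨n, by rw [Metric.mem_ball]; linarith⟩

/-- Disjoint balls of positive measure are countably many in a σ-finite space, so Vitali's covering
lemma yields countable ε-dense sets. Product measurability and Tonelli on X × X depend on this. -/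
theorem IsDoubling.secondCountableTopology [BorelSpace X] (hμ : IsDoubling μ) :
    SecondCountableTopology X := by
  have := hμ.sigmaFinite
  obtain ⟨C, hC⟩ := hμ
  refine Metric.secondCountable_of_almost_dense_set fun ε hε => ?_
  obtain ⟨T, -, hT, hT'⟩ := Vitali.exists_disjoint_subfamily_covering_enlargement_closedBall
    (univ : Set X) id (fun _ => ε / 4) (ε / 4) (fun _ _ => le_rfl) 4 (by norm_num)
  refine ⟨T, ?_, fun x => ?_⟩
  · have h := Measure.countable_meas_pos_of_disjoint_iUnion (μ := μ)
      (As := fun x : T => Metric.closedBall (x : X) (ε / 4))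
      (fun _ => Metric.isClosed_closedBall.measurableSet)
      (fun x y hxy => hT x.2 y.2 (Subtype.coe_injective.ne hxy))
    have huniv : {i : T | 0 < μ (Metric.closedBall (i : X) (ε / 4))} = univ :=
      eq_univ_of_forall fun x => (hC x _ (by positivity)).1.trans_le
        (measure_mono Metric.ball_subset_closedBall)
    rw [huniv] at h
    exact countable_coe_iff.1 (countable_univ_iff.1 h)
  · obtain ⟨y, hy, hxy⟩ := hT' x (mem_univ x)
    refine ⟨y, hy, ?_⟩
    have := hxy (Metric.mem_closedBall_self (by positivity))
    rw [Metric.mem_closedBall] at this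
    simp only [id] at this
    linarith

theorem IsDoubling.measure_lt_top (hμ : IsDoubling μ) {A : Set X} (hA : Bornology.IsBounded A) :
    μ A < ∞ := by
  obtain ⟨C, hC⟩ := hμ
  rcases A.eq_empty_or_nonempty with rfl | ⟨x, -⟩
  · simp
  · obtain ⟨r, hr, hAr⟩ := hA.subset_ball_lt 0 x
    exact (measure_mono hAr).trans_lt (hC x r hr).2.1

theorem IsDoubling.measure_ball_inter_ne_zero (hμ : IsDoubling μ) {Ω : Set X} (hΩ : IsOpen Ω)
    {x : X} (hx : x ∈ closure Ω) {r : ℝ} (hr : 0 < r) : μ (Metric.ball x r ∩ Ω) ≠ 0 := by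
  obtain ⟨C, hC⟩ := hμ
  obtain ⟨z, hz⟩ := mem_closure_iff.1 hx _ Metric.isOpen_ball (Metric.mem_ball_self hr)
  obtain ⟨ε, hε, hεs⟩ := Metric.isOpen_iff.1 (Metric.isOpen_ball.inter hΩ) z hz
  exact ((hC z ε hε).1.trans_le (measure_mono hεs)).ne'

theorem IsDoubling.measure_ball_inter_ne_top (hμ : IsDoubling μ) (Ω : Set X) (x : X) (r : ℝ) :
    μ (Metric.ball x r ∩ Ω) ≠ ∞ :=
  (hμ.measure_lt_top (Metric.isBounded_ball.subset inter_subset_left)).ne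

theorem IsDoubling.exists_measure_ball_pow_le (hμ : IsDoubling μ) :
    ∃ C : ℝ≥0, 1 ≤ C ∧ ∀ (n : ℕ) (x : X) (r : ℝ), 0 < r →
      μ (Metric.ball x (2 ^ n * r)) ≤ C ^ n * μ (Metric.ball x r) := by
  obtain ⟨C, hC⟩ := hμ
  refine ⟨max 1 C, le_max_left _ _, fun n x r hr => ?_⟩
  induction n with
  | zero => simp
  | succ n ih =>
    calc μ (Metric.ball x (2 ^ (n + 1) * r)) = μ (Metric.ball x (2 * (2 ^ n * r))) := by
          ring_nf
      _ ≤ C * μ (Metric.ball x (2 ^ n * r)) := (hC x _ (by positivity)).2.2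
      _ ≤ (max 1 C : ℝ≥0) * ((max 1 C : ℝ≥0) ^ n * μ (Metric.ball x r)) := by
          gcongr
          exact le_max_right _ _
      _ = _ := by ring

end Doubling

theorem isFiniteMeasure_perimeterMeasure {X : Type*} [MetricSpace X] [MeasurableSpace X] [BorelSpace X]
    {μ : Measure X} {E : Set X} (h : perimeter μ E univ < ∞) :
    IsFiniteMeasure (perimeterMeasure μ E) := by
  refine ⟨lt_of_le_of_lt ?_ h⟩
  rw [perimeterMeasure, toMeasure_apply _ _ MeasurableSet.univ, perimeterOuter]
  exact (OuterMeasure.ofFunction_le _).trans_eq (extend_eq _ isOpen_univ)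

/-! ### Local estimates at the boundary -/

section Boundary

variable {X : Type*} [MetricSpace X] [MeasurableSpace X] [BorelSpace X] {μ : Measure X} {p : ℝ}
  {Ω : Set X}

/-- Measure density and codimension `1` regularity in the form used at boundary points. -/
theorem AdmissibleDomain.exists_boundary_constant (hμ : IsDoubling μ)
    (hΩ : AdmissibleDomain μ p Ω) : ∃ K : ℝ≥0, 1 ≤ K ∧
      (∀ x r, 0 < r → μ (Metric.ball x (4 * r)) ≤ K * μ (Metric.ball x r)) ∧
      ∀ x ∈ frontier Ω, ∀ r, 0 < r → r ≤ Metric.diam Ω →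
        μ (Metric.ball x (4 * r)) ≤ K * μ (Metric.ball x r ∩ Ω) ∧
        perimeterMeasure μ Ω (Metric.ball x r) ≤
          K * (μ (Metric.ball x r) / ENNReal.ofReal r) := by
  obtain ⟨D, hD1, hD⟩ := hμ.exists_measure_ball_pow_le
  obtain ⟨C, hC1, hC⟩ := hΩ.regular
  have hDK : D ^ 2 ≤ D ^ 4 * C := (pow_le_pow_right₀ hD1 (by norm_num)).trans
    (le_mul_of_one_le_right zero_le hC1)
  have hCK : C ≤ D ^ 4 * C := le_mul_of_one_le_left zero_le (one_le_pow₀ hD1)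
  refine ⟨D ^ 4 * C, hC1.trans hCK, fun x r hr => ?_, fun x hx r hr hrd => ⟨?_, ?_⟩⟩
  · calc μ (Metric.ball x (4 * r)) = μ (Metric.ball x (2 ^ 2 * r)) := by norm_num
      _ ≤ (D : ℝ≥0∞) ^ 2 * μ (Metric.ball x r) := hD 2 x r hr
      _ ≤ _ := by
          gcongr
          exact_mod_cast hDK
  -- Measure density is assumed only at points of Ω, so the centre moves to a nearby z, with B(x,
  -- 4r) ⊆ B(z, 8r) and B(z, r/2) ⊆ B(x, r).
  · obtain ⟨z, hzΩ, hz⟩ := Metric.mem_closure_iff.1 hx.1 (r / 2) (by positivity)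
    calc μ (Metric.ball x (4 * r)) ≤ μ (Metric.ball z (2 ^ 4 * (r / 2))) :=
          measure_mono (Metric.ball_subset_ball' (by linarith))
      _ ≤ (D : ℝ≥0∞) ^ 4 * μ (Metric.ball z (r / 2)) := hD 4 z _ (by positivity)
      _ ≤ (D : ℝ≥0∞) ^ 4 * (C * μ (Metric.ball z (r / 2) ∩ Ω)) := by
          gcongr
          exact (hC (r / 2) (by positivity) (by linarith)).1 z hzΩ
      _ ≤ (D : ℝ≥0∞) ^ 4 * (C * μ (Metric.ball x r ∩ Ω)) := by
          gcongr
          exact Metric.ball_subset_ball' (by rw [dist_comm]; linarith)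
      _ = _ := by push_cast; ring
  · refine ((hC r hr hrd).2 x hx).2.trans ?_
    gcongr

/-- The Poincaré inequality on the traces in `Ω` of balls centred at the boundary. -/
theorem AdmissibleDomain.poincare_boundary (hp : 0 < p) (hμ : IsDoubling μ)
    (hΩ : AdmissibleDomain μ p Ω) : ∃ C : ℝ≥0∞, C ≠ ∞ ∧ ∀ (u : X → ℝ) (g : X → ℝ≥0∞),
      IntegrableOn u Ω μ → IsUpperGradient Ω u g → ∀ x ∈ frontier Ω, ∀ r, 0 < r →
      r ≤ Metric.diam Ω →
      ⨍⁻ y in Metric.ball x r ∩ Ω, ‖u y - ⨍ z in Metric.ball x r ∩ Ω, u z ∂μ‖ₑ ∂μ ≤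
        C * ENNReal.ofReal r * (⨍⁻ y in Metric.ball x (4 * r) ∩ Ω, g y ^ p ∂μ) ^ (1 / p) := by
  obtain ⟨K, hK1, -, hK⟩ := hΩ.exists_boundary_constant hμ
  obtain ⟨C, -, hC⟩ := hΩ.poincare
  have hKp : (K : ℝ≥0∞) ^ (1 / p) ≠ ∞ :=
    ENNReal.rpow_ne_top_of_nonneg (by positivity) ENNReal.coe_ne_top
  refine ⟨4 * K * C * (K : ℝ≥0∞) ^ (1 / p), by finiteness, fun u g hu hg x hx r hr hrd => ?_⟩
  -- The Poincaré inequality needs a centre in Ω: B(x, r) ⊆ B(z, 2r) ⊆ B(x, 4r), and the traces of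
  -- these balls in Ω have comparable measure.
  obtain ⟨z, hzΩ, hz⟩ := Metric.mem_closure_iff.1 hx.1 r hr
  set A := Metric.ball x r ∩ Ω
  set S := Metric.ball z (2 * r) ∩ Ω
  set T := Metric.ball x (4 * r) ∩ Ω
  have hAS : A ⊆ S := inter_subset_inter_left _ (Metric.ball_subset_ball' (by linarith))
  have hST : S ⊆ T := inter_subset_inter_left _
    (Metric.ball_subset_ball' (by rw [dist_comm]; linarith))
  have hA0 : μ A ≠ 0 := hμ.measure_ball_inter_ne_zero hΩ.isOpen hx.1 hr
  have hA : μ A ≠ ∞ := hμ.measure_ball_inter_ne_top Ω x r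
  have hTA : μ T ≤ K * μ A := (measure_mono inter_subset_left).trans (hK x hx r hr hrd).1
  have hS0 : μ S ≠ 0 := fun h => hA0 (measure_mono_null hAS h)
  have hpoinc := hC u g (fun B hB _ _ => hu.mono_set hB) hg z hzΩ (2 * r) (by positivity)
  rw [one_mul] at hpoinc
  set c := ⨍ y in S, u y ∂μ
  set m := ⨍ y in A, u y ∂μ
  calc ⨍⁻ y in A, ‖u y - m‖ₑ ∂μ
      ≤ (⨍⁻ y in A, ‖u y - c‖ₑ ∂μ) + ‖c - m‖ₑ := setLAverage_enorm_sub_le hA0 hA u c m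
    _ ≤ (⨍⁻ y in A, ‖u y - c‖ₑ ∂μ) + ⨍⁻ y in A, ‖u y - c‖ₑ ∂μ := by
        gcongr
        rw [enorm_sub_rev]
        exact enorm_setAverage_sub_le hA0 hA (hu.mono_set inter_subset_right) c
    _ = 2 * ⨍⁻ y in A, ‖u y - c‖ₑ ∂μ := (two_mul _).symm
    _ ≤ 2 * (K * ⨍⁻ y in S, ‖u y - c‖ₑ ∂μ) := by
        gcongr
        exact setLAverage_le_mul_of_subset ENNReal.coe_ne_top hA0 hAS
          ((measure_mono hST).trans hTA) _
    _ ≤ 2 * (K * (C * ENNReal.ofReal (2 * r) *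
          (K * ⨍⁻ y in T, g y ^ p ∂μ) ^ (1 / p))) := by
        gcongr
        refine hpoinc.trans ?_
        gcongr
        exact setLAverage_le_mul_of_subset ENNReal.coe_ne_top hS0 hST
          (hTA.trans (by gcongr)) _
    _ = _ := by
        rw [ENNReal.mul_rpow_of_nonneg _ _ (by positivity), ENNReal.ofReal_mul (by norm_num),
          ENNReal.ofReal_ofNat]
        ring

/-! ### Ball averages as functions of the centre, and their integrals along the boundary -/

variable [SecondCountableTopology X] [SFinite μ]

theorem measurableSet_dist_lt (r : ℝ) : MeasurableSet {q : X × X | dist q.2 q.1 < r} :=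
  (isOpen_lt (continuous_snd.dist continuous_fst) continuous_const).measurableSet

theorem measurable_setLIntegral_ball_inter {h : X → ℝ≥0∞}
    (hh : Measurable h) (r : ℝ) :
    Measurable fun x => ∫⁻ y in Metric.ball x r ∩ Ω, h y ∂μ := by
  have hm : Measurable fun q : X × X => {q : X × X | dist q.2 q.1 < r}.indicator
      (fun q => h q.2) q := (hh.comp measurable_snd).indicator (measurableSet_dist_lt r)
  have := hm.lintegral_prod_right' (ν := μ.restrict Ω)
  refine (congrArg Measurable (funext fun x => ?_)).mp this
  symm
  rw [← Measure.restrict_restrict Metric.isOpen_ball.measurableSet,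
    ← lintegral_indicator Metric.isOpen_ball.measurableSet]
  rfl

theorem measurable_measure_ball_inter (r : ℝ) :
    Measurable fun x => μ (Metric.ball x r ∩ Ω) := by
  simpa using measurable_setLIntegral_ball_inter (μ := μ) measurable_one r

theorem measurable_setLAverage_ball_inter {h : X → ℝ≥0∞}
    (hh : Measurable h) (r : ℝ) :
    Measurable fun x => ⨍⁻ y in Metric.ball x r ∩ Ω, h y ∂μ := by
  simp only [setLAverage_eq]
  exact (measurable_setLIntegral_ball_inter hh r).div (measurable_measure_ball_inter r)

theorem stronglyMeasurable_setAverage_ball_inter {u : X → ℝ}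
    (hu : AEStronglyMeasurable u (μ.restrict Ω)) (r : ℝ) :
    StronglyMeasurable fun x => ⨍ y in Metric.ball x r ∩ Ω, u y ∂μ := by
  have hm : StronglyMeasurable fun q : X × X => {q : X × X | dist q.2 q.1 < r}.indicator
      (fun q => hu.mk u q.2) q :=
    (hu.stronglyMeasurable_mk.comp_measurable measurable_snd).indicator (measurableSet_dist_lt r)
  have h1 := hm.integral_prod_right' (ν := μ.restrict Ω)
  have h2 : StronglyMeasurable fun x => (μ.real (Metric.ball x r ∩ Ω))⁻¹ :=
    (measurable_measure_ball_inter r).ennreal_toReal.inv.stronglyMeasurable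
  refine (congrArg StronglyMeasurable (funext fun x => ?_)).mp (h2.mul h1)
  symm
  rw [setAverage_eq, smul_eq_mul, Pi.mul_apply]
  congr 1
  rw [← Measure.restrict_restrict Metric.isOpen_ball.measurableSet,
    integral_congr_ae (ae_restrict_of_ae hu.ae_eq_mk),
    ← integral_indicator Metric.isOpen_ball.measurableSet]
  rfl

/-- Averages over small balls centred at the boundary are integrable along the boundary. -/
theorem lintegral_frontier_setLAverage_le {P : Measure X} [SFinite P]
    {K : ℝ≥0} {r : ℝ} (hr : 0 < r) (hpos : ∀ x, μ (Metric.ball x r) ≠ 0)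
    (hfin : ∀ x, μ (Metric.ball x r) ≠ ∞)
    (hdbl : ∀ x, μ (Metric.ball x (4 * r)) ≤ K * μ (Metric.ball x r))
    (hdens : ∀ x ∈ frontier Ω, μ (Metric.ball x (2 * r)) ≤ K * μ (Metric.ball x r ∩ Ω))
    (hP : ∀ x ∈ frontier Ω, P (Metric.ball x (2 * r)) ≤
      K * (μ (Metric.ball x (2 * r)) / ENNReal.ofReal (2 * r)))
    {h : X → ℝ≥0∞} (hh : AEMeasurable h (μ.restrict Ω)) :
    ∫⁻ x in frontier Ω, ⨍⁻ y in Metric.ball x r ∩ Ω, h y ∂μ ∂P ≤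
      K ^ 3 / ENNReal.ofReal r * ∫⁻ y in Ω, h y ∂μ := by
  wlog hhm : Measurable h generalizing h
  · have := this (h := hh.mk h) hh.measurable_mk.aemeasurable hh.measurable_mk
    rw [← lintegral_congr_ae hh.ae_eq_mk] at this
    refine le_trans (le_of_eq ?_) this
    refine lintegral_congr fun x => laverage_congr ?_
    rw [← Measure.restrict_restrict Metric.isOpen_ball.measurableSet]
    exact ae_restrict_of_ae hh.ae_eq_mk
  have hmb : Measurable fun y => μ (Metric.ball y r) := by
    simpa using measurable_measure_ball_inter (μ := μ) (Ω := univ) r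
  -- For d(x, y) < r the weight 1/μ(B(x, r) ∩ Ω) is at most K/μ(B(y, r)), which is free of x. After
  -- Tonelli, only P(B(y, r) ∩ ∂Ω) remains to be bounded.
  set F : X × X → ℝ≥0∞ := {q : X × X | dist q.2 q.1 < r}.indicator
    (fun q => K * (μ (Metric.ball q.2 r))⁻¹ * h q.2) with hF
  have hFm : Measurable F :=
    ((((hmb.comp measurable_snd).inv).const_mul _).mul (hhm.comp measurable_snd)).indicator
      (measurableSet_dist_lt r)
  have hr2 : ENNReal.ofReal r ≠ 0 := by simpa using hr
  calc ∫⁻ x in frontier Ω, ⨍⁻ y in Metric.ball x r ∩ Ω, h y ∂μ ∂P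
      ≤ ∫⁻ x in frontier Ω, ∫⁻ y in Ω, F (x, y) ∂μ ∂P := by
        refine setLIntegral_mono hFm.lintegral_prod_right' fun x hx => ?_
        have hEq : ∫⁻ y in Ω, F (x, y) ∂μ =
            ∫⁻ y in Metric.ball x r ∩ Ω, K * (μ (Metric.ball y r))⁻¹ * h y ∂μ := by
          rw [← Measure.restrict_restrict Metric.isOpen_ball.measurableSet,
            ← lintegral_indicator Metric.isOpen_ball.measurableSet]
          rfl
        rw [hEq, setLAverage_eq, ENNReal.div_eq_inv_mul,
          ← lintegral_const_mul _ hhm]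
        refine setLIntegral_mono ((hmb.inv.const_mul _).mul hhm) fun y hy => ?_
        gcongr
        have hle : μ (Metric.ball y r) ≤ K * μ (Metric.ball x r ∩ Ω) :=
          (measure_mono (Metric.ball_subset_ball' (by
            have := Metric.mem_ball.1 hy.1
            linarith))).trans (hdens x hx)
        have hK0 : (K : ℝ≥0∞) ≠ 0 := by
          intro h0
          rw [h0, zero_mul] at hle
          exact hpos y (le_antisymm hle zero_le)
        calc (μ (Metric.ball x r ∩ Ω))⁻¹ = K * (K * μ (Metric.ball x r ∩ Ω))⁻¹ := by
              rw [ENNReal.mul_inv (Or.inl hK0) (Or.inl ENNReal.coe_ne_top), ← mul_assoc,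
                ENNReal.mul_inv_cancel hK0 ENNReal.coe_ne_top, one_mul]
          _ ≤ _ := by gcongr
    _ = ∫⁻ y in Ω, ∫⁻ x in frontier Ω, F (x, y) ∂P ∂μ :=
        lintegral_lintegral_swap hFm.aemeasurable
    _ ≤ ∫⁻ y in Ω, K ^ 3 / ENNReal.ofReal r * h y ∂μ := by
        refine lintegral_mono fun y => ?_
        have hEq : ∀ x, F (x, y) = (Metric.ball y r).indicator
            (fun _ => K * (μ (Metric.ball y r))⁻¹ * h y) x := fun x => by
          simp only [hF, indicator, mem_ofPred_eq, Metric.mem_ball, dist_comm]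
        simp only [hEq]
        rw [lintegral_indicator_const Metric.isOpen_ball.measurableSet,
          Measure.restrict_apply Metric.isOpen_ball.measurableSet]
        -- The upper perimeter bound holds at boundary points only: if the ball meets ∂Ω at x, it
        -- lies in B(x, 2r). This step costs two factors K, the kernel the third.
        have hPy : P (Metric.ball y r ∩ frontier Ω) ≤
            K * (K * μ (Metric.ball y r) / ENNReal.ofReal r) := by
          rcases (Metric.ball y r ∩ frontier Ω).eq_empty_or_nonempty with he | ⟨x, hxy, hx⟩
          · simp [he]
          rw [Metric.mem_ball] at hxy
          calc P (Metric.ball y r ∩ frontier Ω) ≤ P (Metric.ball x (2 * r)) :=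
                measure_mono (inter_subset_left.trans (Metric.ball_subset_ball' (by
                  rw [dist_comm]
                  linarith)))
            _ ≤ K * (μ (Metric.ball x (2 * r)) / ENNReal.ofReal (2 * r)) := hP x hx
            _ ≤ K * (μ (Metric.ball y (4 * r)) / ENNReal.ofReal r) := by
                gcongr
                · exact Metric.ball_subset_ball' (by linarith)
                · linarith
            _ ≤ _ := by
                gcongr
                exact hdbl y
        calc K * (μ (Metric.ball y r))⁻¹ * h y * P (Metric.ball y r ∩ frontier Ω)
            ≤ K * (μ (Metric.ball y r))⁻¹ * h y *
                (K * (K * μ (Metric.ball y r) / ENNReal.ofReal r)) := by gcongr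
          _ = (K ^ 3 / ENNReal.ofReal r * h y) *
                ((μ (Metric.ball y r))⁻¹ * μ (Metric.ball y r)) := by
              rw [div_eq_mul_inv, div_eq_mul_inv]
              ring
          _ = _ := by rw [ENNReal.inv_mul_cancel (hpos y) (hfin y), mul_one]
    _ = _ := lintegral_const_mul _ hhm

end Boundary

/-! ### The trace theorem -/

section TraceTheorem

theorem lintegral_rpow_one_div_le {α : Type*} [MeasurableSpace α] {P : Measure α} {p : ℝ}
    (hp : 1 < p) {G : α → ℝ≥0∞} (hG : AEMeasurable G P) :
    ∫⁻ x, G x ^ (1 / p) ∂P ≤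
      (∫⁻ x, G x ∂P) ^ (1 / p) * P univ ^ (1 / p.conjExponent) := by
  have hp0 : p ≠ 0 := by positivity
  have h := ENNReal.lintegral_mul_le_Lp_mul_Lq P (Real.HolderConjugate.conjExponent hp)
    (hG.pow_const (1 / p)) (aemeasurable_const (b := (1 : ℝ≥0∞)))
  simpa [← ENNReal.rpow_mul, hp0] using h

theorem tsum_geometric_rpow_ne_top {R s : ℝ} (hs : 0 < s) :
    ∑' k : ℕ, ENNReal.ofReal (R * (1 / 2) ^ k) ^ s ≠ ∞ := by
  have hq : (2⁻¹ : ℝ≥0∞) ^ s < 1 := ENNReal.rpow_lt_one (by norm_num) hs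
  have h : ∀ k : ℕ, ENNReal.ofReal (R * (1 / 2) ^ k) ^ s =
      ENNReal.ofReal R ^ s * ((2⁻¹ : ℝ≥0∞) ^ s) ^ k := fun k => by
    rw [ENNReal.ofReal_mul' (by positivity), ENNReal.mul_rpow_of_nonneg _ _ hs.le,
      ENNReal.ofReal_pow (by norm_num), ← ENNReal.rpow_natCast, ← ENNReal.rpow_mul,
      ← ENNReal.rpow_natCast, ← ENNReal.rpow_mul, mul_comm s]
    congr 3
    rw [one_div, ENNReal.ofReal_inv_of_pos (by norm_num), ENNReal.ofReal_ofNat]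
  simp only [h]
  rw [ENNReal.tsum_mul_left, ENNReal.tsum_geometric]
  refine ENNReal.mul_ne_top (ENNReal.rpow_ne_top_of_nonneg hs.le ENNReal.ofReal_ne_top) ?_
  exact ENNReal.inv_ne_top.2 (tsub_pos_of_lt hq).ne'

theorem frontier_eq_empty_of_diam_eq_zero {X : Type*} [MetricSpace X] {Ω : Set X} (hΩ : IsOpen Ω) (hb : Bornology.IsBounded Ω)
    (hd : Metric.diam Ω = 0) : frontier Ω = ∅ := by
  have hs : Ω.Subsingleton := fun x hx y hy =>
    dist_le_zero.1 ((Metric.dist_le_diam_of_mem hb hx hy).trans_eq hd)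
  rw [frontier, hs.isClosed.closure_eq, hΩ.interior_eq, sdiff_self]

theorem Newtonian.integrableOn {X : Type*} [MetricSpace X] [MeasurableSpace X] {μ : Measure X}
    {p : ℝ} {Ω : Set X} {u : X → ℝ} (hp : 1 ≤ p) (hμΩ : μ Ω ≠ ∞) (hu : u ∈ Newtonian μ p Ω) :
    IntegrableOn u Ω μ := by
  have : IsFiniteMeasure (μ.restrict Ω) := isFiniteMeasure_restrict.2 hμΩ
  exact hu.1.integrable (by simpa using hp)

variable {X : Type*} [MetricSpace X] [MeasurableSpace X] [BorelSpace X] {μ : Measure X} {p : ℝ}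
  {Ω : Set X} {u : X → ℝ}

/-- Newtonian functions have an integrable trace almost everywhere on the boundary. -/
theorem AdmissibleDomain.trace_theorem (hp : 1 < p) (hμ : IsDoubling μ)
    (hΩ : AdmissibleDomain μ p Ω) (hu : u ∈ Newtonian μ p Ω) :
    (∀ᵐ x ∂(perimeterMeasure μ Ω).restrict (frontier Ω), HasTraceAt μ Ω u x (trace μ Ω u x)) ∧
      IntegrableOn (trace μ Ω u) (frontier Ω) (perimeterMeasure μ Ω) := by
  -- For diameter 0 the regularity assumption is void, but then the boundary is empty.
  rcases Metric.diam_nonneg (s := Ω) |>.eq_or_lt' with hd | hd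
  · simp [frontier_eq_empty_of_diam_eq_zero hΩ.isOpen hΩ.isBounded hd]
  have hp0 : 0 < p := one_pos.trans hp
  have := hμ.sigmaFinite
  have := hμ.secondCountableTopology
  have := isFiniteMeasure_perimeterMeasure hΩ.finite_perimeter
  have hui := Newtonian.integrableOn hp.le (hμ.measure_lt_top hΩ.isBounded).ne hu
  obtain ⟨-, g, hg, hgp⟩ := hu
  obtain ⟨K, hK1, hK, hKb⟩ := hΩ.exists_boundary_constant hμ
  obtain ⟨C, hC, hpoinc⟩ := hΩ.poincare_boundary hp0 hμ
  set P := perimeterMeasure μ Ω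
  -- The Poincaré inequality enlarges radii by 4 and the boundary integral estimate by 2, so 8R must
  -- not exceed the diameter.
  set R := Metric.diam Ω / 8
  have hR : 0 < R := by positivity
  set r : ℕ → ℝ := fun k => R * (1 / 2) ^ k
  have hr : ∀ k, 0 < r k := fun k => by positivity
  have hrR : ∀ k, r k ≤ R := fun k =>
    mul_le_of_le_one_right hR.le (pow_le_one₀ (by norm_num) (by norm_num))
  have hpos : ∀ x ∈ frontier Ω, ∀ s > 0, μ (Metric.ball x s ∩ Ω) ≠ 0 := fun x hx s hs =>
    hμ.measure_ball_inter_ne_zero hΩ.isOpen hx.1 hs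
  have hfin := hμ.measure_ball_inter_ne_top Ω
  have haem : ∀ x s, AEMeasurable u (μ.restrict (Metric.ball x s ∩ Ω)) := fun x s =>
    hui.1.aemeasurable.mono_measure (Measure.restrict_mono inter_subset_right le_rfl)
  have htonelli : ∀ s, 0 < s → 2 * s ≤ Metric.diam Ω → ∀ h : X → ℝ≥0∞,
      AEMeasurable h (μ.restrict Ω) →
      ∫⁻ x in frontier Ω, ⨍⁻ y in Metric.ball x s ∩ Ω, h y ∂μ ∂P ≤
        K ^ 3 / ENNReal.ofReal s * ∫⁻ y in Ω, h y ∂μ := by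
    intro s hs hs2 h hh
    refine lintegral_frontier_setLAverage_le hs (fun x => ?_) (fun x => ?_) (fun x => hK x s hs)
      (fun x hx => ?_) (fun x hx => (hKb x hx (2 * s) (by positivity) hs2).2) hh
    · simpa using hμ.measure_ball_inter_ne_zero isOpen_univ (x := x) (by simp) hs
    · exact (hμ.measure_lt_top Metric.isBounded_ball).ne
    · exact (measure_mono (Metric.ball_subset_ball (by linarith))).trans
        (hKb x hx s hs (by linarith)).1
  set G : ℕ → X → ℝ≥0∞ := fun k x => ⨍⁻ y in Metric.ball x (4 * r k) ∩ Ω, g y ^ p ∂μ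
  have hGm : ∀ k, Measurable (G k) := fun k =>
    measurable_setLAverage_ball_inter (hg.1.pow_const p) _
  set d : ℕ → X → ℝ≥0∞ := fun k x => C * ENNReal.ofReal (r k) * G k x ^ (1 / p)
  have hdm : ∀ k, Measurable (d k) := fun k => ((hGm k).pow_const _).const_mul _
  set I := ∫⁻ x in Ω, g x ^ p ∂μ
  set M := (P.restrict (frontier Ω)) univ ^ (1 / p.conjExponent)
  have hM : M ≠ ∞ := ENNReal.rpow_ne_top_of_nonneg
    (one_div_nonneg.2 (Real.HolderConjugate.conjExponent hp).symm.nonneg) (measure_ne_top _ _)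
  have hs : 0 < 1 - 1 / p := by
    rw [sub_pos, div_lt_one hp0]
    exact hp
  -- The factor r from the Poincaré inequality meets r^(-1/p) from averaging g^p along a set of
  -- codimension 1. As p > 1, the exponent 1 − 1/p is positive and the dyadic sum converges.
  have hdint : ∀ k, ∫⁻ x in frontier Ω, d k x ∂P ≤
      C * (K ^ 3 * I) ^ (1 / p) * M * ENNReal.ofReal (r k) ^ (1 - 1 / p) := by
    intro k
    have hrk0 : ENNReal.ofReal (r k) ≠ 0 := by simpa using hr k
    rw [lintegral_const_mul _ ((hGm k).pow_const _)]
    calc C * ENNReal.ofReal (r k) * ∫⁻ x in frontier Ω, G k x ^ (1 / p) ∂P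
        ≤ C * ENNReal.ofReal (r k) * ((∫⁻ x in frontier Ω, G k x ∂P) ^ (1 / p) * M) := by
          gcongr
          exact lintegral_rpow_one_div_le hp (hGm k).aemeasurable
      _ ≤ C * ENNReal.ofReal (r k) *
          ((K ^ 3 / ENNReal.ofReal (r k) * I) ^ (1 / p) * M) := by
          gcongr
          refine (htonelli (4 * r k) (by linarith [hr k]) ?_ _
            (hg.1.pow_const p).aemeasurable).trans ?_
          · have := hrR k
            simp only [R] at this
            linarith
          · gcongr
            linarith [hr k]
      _ = C * (K ^ 3 * I) ^ (1 / p) * M *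
          (ENNReal.ofReal (r k) * (ENNReal.ofReal (r k))⁻¹ ^ (1 / p)) := by
          rw [div_eq_mul_inv, mul_right_comm ((K : ℝ≥0∞) ^ 3),
            ENNReal.mul_rpow_of_nonneg _ _ (by positivity)]
          ring
      _ = _ := by
          rw [ENNReal.inv_rpow, ← ENNReal.rpow_neg, sub_eq_add_neg,
            ENNReal.rpow_add _ _ hrk0 ENNReal.ofReal_ne_top, ENNReal.rpow_one]
  have hsumint : ∫⁻ x in frontier Ω, ∑' k, d k x ∂P ≠ ∞ := by
    rw [lintegral_tsum fun k => (hdm k).aemeasurable]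
    refine ne_top_of_le_ne_top ?_ (ENNReal.tsum_le_tsum hdint)
    rw [ENNReal.tsum_mul_left]
    have hKI : (K ^ 3 * I) ^ (1 / p) ≠ ∞ := ENNReal.rpow_ne_top_of_nonneg (by positivity)
      (ENNReal.mul_ne_top (by finiteness) hgp.ne)
    exact ENNReal.mul_ne_top (ENNReal.mul_ne_top (ENNReal.mul_ne_top hC hKI) hM)
      (tsum_geometric_rpow_ne_top hs)
  have hkey : ∀ᵐ x ∂P.restrict (frontier Ω),
      Tendsto (fun k => ⨍ z in Metric.ball x (r k) ∩ Ω, u z ∂μ) atTop (𝓝 (trace μ Ω u x)) ∧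
      HasTraceAt μ Ω u x (trace μ Ω u x) ∧
      ‖(⨍ z in Metric.ball x R ∩ Ω, u z ∂μ) - trace μ Ω u x‖ₑ ≤ K * ∑' k, d k x := by
    filter_upwards [ae_lt_top (Measurable.tsum hdm) hsumint,
      ae_restrict_mem isClosed_frontier.measurableSet] with x hx hxΩ
    have hdbl : ∀ k, μ (Metric.ball x (r k) ∩ Ω) ≤ K * μ (Metric.ball x (r (k + 1)) ∩ Ω) := by
      intro k
      refine (measure_mono (inter_subset_left.trans (Metric.ball_subset_ball ?_))).trans
        (hKb x hxΩ (r (k + 1)) (hr _) ?_).1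
      · have := hr k
        simp only [r, pow_succ] at this ⊢
        linarith
      · have := hrR (k + 1)
        simp only [R] at this
        linarith
    obtain ⟨t, h1, h2, h3⟩ := exists_hasTraceAt_of_tsum_ne_top hR ENNReal.coe_ne_top
      (hpos x hxΩ) (hfin x) hdbl hui (d := fun k => d k x)
      (fun k => hpoinc u g hui hg x hxΩ (r k) (hr k) (by
        have := hrR k
        simp only [R] at this
        linarith)) hx.ne
    rw [h2.trace_eq (hpos x hxΩ) (hfin x) (haem x)]
    exact ⟨h1, h2, h3⟩
  refine ⟨hkey.mono fun x hx => hx.2.1, ?_, ?_⟩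
  · exact aestronglyMeasurable_of_tendsto_ae atTop
      (fun k => (stronglyMeasurable_setAverage_ball_inter hui.1 (r k)).aestronglyMeasurable)
      (hkey.mono fun x hx => hx.1)
  -- The trace is dominated by the mean of |u| at the top scale R plus the telescoped oscillations;
  -- both are integrable over ∂Ω.
  · have hA : ∫⁻ x in frontier Ω, ⨍⁻ y in Metric.ball x R ∩ Ω, ‖u y‖ₑ ∂μ ∂P < ∞ := by
      refine (htonelli R hR (by simp only [R]; linarith) _ hui.1.enorm).trans_lt ?_
      refine ENNReal.mul_lt_top (ENNReal.div_lt_top (by finiteness) ?_) hui.2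
      simpa using hR
    have hB : ∫⁻ x in frontier Ω, K * ∑' k, d k x ∂P < ∞ := by
      rw [lintegral_const_mul _ (Measurable.tsum hdm)]
      exact ENNReal.mul_lt_top ENNReal.coe_lt_top hsumint.lt_top
    rw [hasFiniteIntegral_iff_enorm]
    refine (lintegral_mono_ae ?_).trans_lt ((lintegral_add_right _
      ((Measurable.tsum hdm).const_mul _)).trans_lt (ENNReal.add_lt_top.2 ⟨hA, hB⟩))
    filter_upwards [hkey, ae_restrict_mem isClosed_frontier.measurableSet] with x hx hxΩ
    set m := ⨍ z in Metric.ball x R ∩ Ω, u z ∂μ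
    calc ‖trace μ Ω u x‖ₑ = ‖m - (m - trace μ Ω u x)‖ₑ := by rw [sub_sub_cancel]
      _ ≤ ‖m‖ₑ + ‖m - trace μ Ω u x‖ₑ := enorm_sub_le
      _ ≤ _ := by
        refine add_le_add ?_ hx.2.2
        simpa using enorm_setAverage_sub_le (hpos x hxΩ R hR) (hfin x R)
          (hui.mono_set inter_subset_right) 0

end TraceTheorem

/-! ### Lipschitz combinations of two functions -/

section Combination

variable {X : Type*} [MetricSpace X] {u v : X → ℝ} {F : ℝ × ℝ → ℝ}

/-- The metric on ℝ × ℝ is the sup metric, which is why max(g, h) suffices. Maximum, minimum and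
midpoint are all 1-Lipschitz for it, also after subtracting a constant. -/
theorem UGIneq.comp_lipschitz (hF : LipschitzWith 1 F) {g h : X → ℝ≥0∞} {γ : ArcCurve X}
    (hu : UGIneq u g γ) (hv : UGIneq v h γ) :
    UGIneq (fun x => F (u x, v x)) (fun x => max (g x) (h x)) γ := by
  refine (hF.edist_le_mul _ _).trans ?_
  rw [ENNReal.coe_one, one_mul, Prod.edist_eq]
  exact max_le (hu.trans (γ.lineIntegral_mono fun _ => le_max_left _ _))
    (hv.trans (γ.lineIntegral_mono fun _ => le_max_right _ _))

/-- Strict convexity needs this sharper bound for the midpoint instead of max(g, h). -/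
theorem UGIneq.half_add {g h : X → ℝ≥0∞} {γ : ArcCurve X}
    (hu : UGIneq u g γ) (hv : UGIneq v h γ) :
    UGIneq (fun x => (u x + v x) / 2) (fun x => 2⁻¹ * (g x + h x)) γ := by
  rw [UGIneq, γ.lineIntegral_const_mul (by simp)]
  set y := γ.toFun γ.len
  set x := γ.toFun 0
  have h2 : ‖(2⁻¹ : ℝ)‖ₑ = 2⁻¹ := by
    rw [Real.enorm_eq_ofReal (by positivity), ENNReal.ofReal_inv_of_pos (by norm_num),
      ENNReal.ofReal_ofNat]
  calc edist ((u y + v y) / 2) ((u x + v x) / 2)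
      = ‖(2⁻¹ : ℝ) * ((u y - u x) + (v y - v x))‖ₑ := by
        rw [edist_eq_enorm_sub]
        congr 1
        ring
    _ ≤ 2⁻¹ * (edist (u y) (u x) + edist (v y) (v x)) := by
        rw [enorm_mul, h2, edist_eq_enorm_sub, edist_eq_enorm_sub]
        gcongr
        exact enorm_add_le _ _
    _ ≤ 2⁻¹ * (γ.lineIntegral g + γ.lineIntegral h) := by
        gcongr
        · exact hu
        · exact hv
    _ ≤ _ := by
        gcongr
        exact le_lintegral_add _ _

variable [MeasurableSpace X] {μ : Measure X} {p : ℝ} {Ω : Set X}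

theorem Newtonian.comp_lipschitz (hμΩ : μ Ω ≠ ∞) (hF : LipschitzWith 1 F)
    (hu : u ∈ Newtonian μ p Ω) (hv : v ∈ Newtonian μ p Ω) :
    (fun x => F (u x, v x)) ∈ Newtonian μ p Ω := by
  have : IsFiniteMeasure (μ.restrict Ω) := isFiniteMeasure_restrict.2 hμΩ
  obtain ⟨hu, g, hg, hgp⟩ := hu
  obtain ⟨hv, h, hh, hhp⟩ := hv
  refine ⟨?_, fun x => max (g x) (h x), ⟨hg.1.max hh.1, fun γ hγ =>
    (hg.2 γ hγ).comp_lipschitz hF (hh.2 γ hγ)⟩, lintegral_max_rpow_lt_top hg.1 hgp hhp⟩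
  have hdom := ((memLp_const (μ := μ.restrict Ω) (p := ENNReal.ofReal p) ‖F 0‖).add hu.norm).add
    hv.norm
  refine hdom.mono' (hF.continuous.comp_aestronglyMeasurable (hu.1.prodMk hv.1))
    (ae_of_all _ fun x => ?_)
  have h1 := hF.dist_le_mul (u x, v x) 0
  rw [NNReal.coe_one, one_mul, dist_zero_right, dist_eq_norm, Prod.norm_def] at h1
  have h2 : max ‖u x‖ ‖v x‖ ≤ ‖u x‖ + ‖v x‖ :=
    max_le_add_of_nonneg (norm_nonneg _) (norm_nonneg _)
  have h3 := norm_le_norm_add_norm_sub' (F (u x, v x)) (F 0)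
  simp only [Pi.add_apply]
  linarith

theorem lipschitzWith_half_add : LipschitzWith 1 fun q : ℝ × ℝ => (q.1 + q.2) / 2 := by
  refine LipschitzWith.of_dist_le_mul fun q q' => ?_
  have h1 := le_max_left (dist q.1 q'.1) (dist q.2 q'.2)
  have h2 := le_max_right (dist q.1 q'.1) (dist q.2 q'.2)
  rw [Prod.dist_eq, NNReal.coe_one, one_mul]
  simp only [Real.dist_eq] at h1 h2 ⊢
  have h3 := abs_add_le (q.1 - q'.1) (q.2 - q'.2)
  rw [show (q.1 + q.2) / 2 - (q'.1 + q'.2) / 2 = ((q.1 - q'.1) + (q.2 - q'.2)) / 2 by ring,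
    abs_div, abs_two]
  linarith

theorem lipschitzWith_max_sub (c : ℝ) : LipschitzWith 1 fun q : ℝ × ℝ => max q.1 q.2 - c := by
  simpa using ((LipschitzWith.prod_fst (α := ℝ) (β := ℝ)).max LipschitzWith.prod_snd).sub
    (LipschitzWith.const c)

theorem lipschitzWith_min_sub (c : ℝ) : LipschitzWith 1 fun q : ℝ × ℝ => min q.1 q.2 - c := by
  simpa using ((LipschitzWith.prod_fst (α := ℝ) (β := ℝ)).min LipschitzWith.prod_snd).sub
    (LipschitzWith.const c)

theorem HasTraceAt.comp_lipschitz (hF : LipschitzWith 1 F) {x : X} {s t : ℝ}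
    (hum : ∀ r, AEMeasurable u (μ.restrict (Metric.ball x r ∩ Ω)))
    (hu : HasTraceAt μ Ω u x s) (hv : HasTraceAt μ Ω v x t) :
    HasTraceAt μ Ω (fun x => F (u x, v x)) x (F (s, t)) := by
  refine HasTraceAt.of_enorm_sub_le hum hu hv fun y => ?_
  have := hF.edist_le_mul (u y, v y) (s, t)
  rw [ENNReal.coe_one, one_mul, Prod.edist_eq, edist_eq_enorm_sub, edist_eq_enorm_sub,
    edist_eq_enorm_sub] at this
  exact this.trans (max_le le_self_add le_add_self)

variable [BorelSpace X]

theorem AdmissibleDomain.trace_comp_lipschitz (hp : 1 < p) (hμ : IsDoubling μ)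
    (hΩ : AdmissibleDomain μ p Ω) (hF : LipschitzWith 1 F)
    (hu : u ∈ Newtonian μ p Ω) (hv : v ∈ Newtonian μ p Ω) :
    ∀ᵐ x ∂(perimeterMeasure μ Ω).restrict (frontier Ω),
      trace μ Ω (fun x => F (u x, v x)) x = F (trace μ Ω u x, trace μ Ω v x) := by
  filter_upwards [(hΩ.trace_theorem hp hμ hu).1, (hΩ.trace_theorem hp hμ hv).1,
    ae_restrict_mem isClosed_frontier.measurableSet] with x h1 h2 hx
  have hmono : ∀ r, μ.restrict (Metric.ball x r ∩ Ω) ≤ μ.restrict Ω := fun r =>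
    Measure.restrict_mono inter_subset_right le_rfl
  have hum := fun r => hu.1.1.aemeasurable.mono_measure (hmono r)
  have hw := Newtonian.comp_lipschitz (hμ.measure_lt_top hΩ.isBounded).ne hF hu hv
  exact (h1.comp_lipschitz hF hum h2).trace_eq
    (fun r hr => hμ.measure_ball_inter_ne_zero hΩ.isOpen hx.1 hr)
    (hμ.measure_ball_inter_ne_top Ω x) fun r => hw.1.1.aemeasurable.mono_measure (hmono r)

end Combination

theorem BoundaryData.integrableOn_mul {X : Type*} [MetricSpace X] [MeasurableSpace X]
    [BorelSpace X] {μ : Measure X} {Ω : Set X} {f T : X → ℝ} (hf : BoundaryData μ Ω f)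
    (hT : IntegrableOn T (frontier Ω) (perimeterMeasure μ Ω)) :
    IntegrableOn (fun x => T x * f x) (frontier Ω) (perimeterMeasure μ Ω) := by
  obtain ⟨M, hM⟩ := hf.bounded
  refine hT.mul_bdd (c := M) hf.measurable.aestronglyMeasurable ?_
  filter_upwards [ae_restrict_mem isClosed_frontier.measurableSet] with x hx using hM x hx

/-! ### Strict convexity of the energy -/

theorem eq_of_rpow_half_add_eq {p : ℝ} (hp : 1 < p) {a b : ℝ≥0∞} (ha : a ≠ ∞) (hb : b ≠ ∞)
    (h : (2⁻¹ * (a + b)) ^ p = 2⁻¹ * a ^ p + 2⁻¹ * b ^ p) : a = b := by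
  have hp0 : 0 ≤ p := by positivity
  lift a to ℝ≥0 using ha
  lift b to ℝ≥0 using hb
  have h' := congrArg ENNReal.toReal h
  rw [ENNReal.toReal_add (by finiteness) (by finiteness)] at h'
  simp only [ENNReal.toReal_mul, ← ENNReal.toReal_rpow, ENNReal.toReal_inv, ENNReal.toReal_ofNat,
    ENNReal.coe_toReal, ENNReal.toReal_add ENNReal.coe_ne_top ENNReal.coe_ne_top] at h'
  by_contra hne
  have hne' : (a : ℝ) ≠ b := fun e => hne (by exact_mod_cast e)
  have := (strictConvexOn_rpow hp).2 (mem_Ici.2 a.2) (mem_Ici.2 b.2) hne'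
    (show (0 : ℝ) < 2⁻¹ by norm_num) (show (0 : ℝ) < 2⁻¹ by norm_num) (by norm_num)
  simp only [smul_eq_mul, ← mul_add] at this h'
  exact this.ne h'

/-- Convexity gives the opposite inequality pointwise, so the assumption forces equality a.e., and
strict convexity applies where both functions are finite. -/
theorem ae_eq_of_lintegral_rpow_half_add {α : Type*} [MeasurableSpace α] {ν : Measure α} {p : ℝ}
    (hp : 1 < p) {g h : α → ℝ≥0∞} (hg : Measurable g) (hh : Measurable h)
    (hgp : ∫⁻ x, g x ^ p ∂ν < ∞) (hhp : ∫⁻ x, h x ^ p ∂ν < ∞)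
    (hle : 2⁻¹ * ∫⁻ x, g x ^ p ∂ν + 2⁻¹ * ∫⁻ x, h x ^ p ∂ν ≤
      ∫⁻ x, (2⁻¹ * (g x + h x)) ^ p ∂ν) : g =ᵐ[ν] h := by
  have hp0 : 0 < p := by positivity
  have hconv : ∀ x, (2⁻¹ * (g x + h x)) ^ p ≤ 2⁻¹ * g x ^ p + 2⁻¹ * h x ^ p := fun x => by
    rw [mul_add]
    exact ENNReal.rpow_arith_mean_le_arith_mean2_rpow _ _ _ _ (ENNReal.inv_two_add_inv_two) hp.le
  have hsum : ∫⁻ x, (2⁻¹ * g x ^ p + 2⁻¹ * h x ^ p) ∂ν =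
      2⁻¹ * ∫⁻ x, g x ^ p ∂ν + 2⁻¹ * ∫⁻ x, h x ^ p ∂ν := by
    rw [lintegral_add_left ((hg.pow_const p).const_mul _), lintegral_const_mul _ (hg.pow_const p),
      lintegral_const_mul _ (hh.pow_const p)]
  have hfin : ∫⁻ x, (2⁻¹ * (g x + h x)) ^ p ∂ν ≠ ∞ := by
    refine ne_top_of_le_ne_top ?_ (lintegral_mono hconv)
    rw [hsum]
    finiteness
  have hae := ae_eq_of_ae_le_of_lintegral_le (ae_of_all ν hconv) hfin
    (((hg.pow_const p).const_mul _).add ((hh.pow_const p).const_mul _)).aemeasurable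
    (hsum.trans_le hle)
  have htop : ∀ k : α → ℝ≥0∞, Measurable k → ∫⁻ x, k x ^ p ∂ν < ∞ → ∀ᵐ x ∂ν, k x ≠ ∞ :=
    fun k hk hkp => (ae_lt_top (hk.pow_const p) hkp.ne).mono fun x hx => by
      rintro e
      rw [e, ENNReal.top_rpow_of_pos hp0] at hx
      exact hx.ne rfl
  filter_upwards [hae, htop g hg hgp, htop h hh hhp] with x hx hgx hhx
  exact eq_of_rpow_half_add_eq hp hgx hhx hx

end NeumannMetric

end

/-- Uniqueness up to the minimal gradient of the normalized minimizers of the Neumann functional,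
and stability of the minimizers under normalized maxima and minima. -/
theorem lemma4p5 {X : Type*} [MetricSpace X] [CompleteSpace X] [MeasurableSpace X] [BorelSpace X]
    (μ : Measure X) (p : ℝ) (hp : 1 < p) (hμ : IsDoubling μ)
    (hX : ∃ lam : ℝ, 0 < lam ∧ SupportsPoincare μ p univ lam)
    (Ω : Set X) (hΩ : AdmissibleDomain μ p Ω) (f : X → ℝ) (hf : BoundaryData μ Ω f)
    (u v : X → ℝ) (hu : u ∈ minimizers μ p Ω f) (hv : v ∈ minimizers μ p Ω f) :
    (IntegrableOn (fun x => trace μ Ω u x * f x) (frontier Ω) (perimeterMeasure μ Ω) ∧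
      IntegrableOn (fun x => trace μ Ω v x * f x) (frontier Ω) (perimeterMeasure μ Ω) ∧
      ∫ x in frontier Ω, trace μ Ω u x * f x ∂(perimeterMeasure μ Ω) =
        ∫ x in frontier Ω, trace μ Ω v x * f x ∂(perimeterMeasure μ Ω)) ∧
    (IsMinimalWeakUpperGradient μ p Ω u (minGrad μ p Ω u) ∧
      IsMinimalWeakUpperGradient μ p Ω v (minGrad μ p Ω v) ∧
      minGrad μ p Ω u =ᵐ[μ.restrict Ω] minGrad μ p Ω v) ∧
    (fun x => max (u x) (v x) - ⨍ y in Ω, max (u y) (v y) ∂μ) ∈ minimizers μ p Ω f ∧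
    (fun x => min (u x) (v x) - ⨍ y in Ω, min (u y) (v y) ∂μ) ∈ minimizers μ p Ω f := by
  have hp0 : 0 < p := by positivity
  have hμΩ : μ Ω ≠ ∞ := (hμ.measure_lt_top hΩ.isBounded).ne
  have hΩfin : IsFiniteMeasure (μ.restrict Ω) := isFiniteMeasure_restrict.2 hμΩ
  have hPfin := isFiniteMeasure_perimeterMeasure hΩ.finite_perimeter
  obtain ⟨⟨huN, hu0⟩, humin⟩ := hu
  obtain ⟨⟨hvN, hv0⟩, hvmin⟩ := hv
  have hgu := Newtonian.isMinimalWeakUpperGradient_minGrad hp0 huN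
  have hgv := Newtonian.isMinimalWeakUpperGradient_minGrad hp0 hvN
  have hTu := (hΩ.trace_theorem hp hμ huN).2
  have hTv := (hΩ.trace_theorem hp hμ hvN).2
  have hTuf := hf.integrableOn_mul hTu
  have hTvf := hf.integrableOn_mul hTv
  have hf1 : IntegrableOn f (frontier Ω) (perimeterMeasure μ Ω) := by
    simpa using hf.integrableOn_mul (T := fun _ => 1) (integrableOn_const (measure_ne_top _ _))
  have hui := Newtonian.integrableOn hp.le hμΩ huN
  have hvi := Newtonian.integrableOn hp.le hμΩ hvN
  have huv : neumannFunctional μ p Ω f u = neumannFunctional μ p Ω f v :=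
    le_antisymm (humin v ⟨hvN, hv0⟩) (hvmin u ⟨huN, hu0⟩)
  have hgrad : minGrad μ p Ω u =ᵐ[μ.restrict Ω] minGrad μ p Ω v := by
    have hwN := Newtonian.comp_lipschitz hμΩ lipschitzWith_half_add huN hvN
    have hw0 : ∫ x in Ω, (u x + v x) / 2 ∂μ = 0 := by
      rw [integral_div, integral_add hui hvi, hu0, hv0]
      simp
    have hle := humin _ ⟨hwN, hw0⟩
    have hgw := Newtonian.isMinimalWeakUpperGradient_minGrad hp0 hwN
    have hbw : boundaryTerm μ Ω f (fun x => (u x + v x) / 2) =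
        (boundaryTerm μ Ω f u + boundaryTerm μ Ω f v) / 2 := by
      rw [boundaryTerm, boundaryTerm, boundaryTerm, ← integral_add hTuf hTvf, ← integral_div]
      refine integral_congr_ae ?_
      filter_upwards [hΩ.trace_comp_lipschitz hp hμ lipschitzWith_half_add huN hvN] with x hx
      rw [hx]
      ring
    have hmid : IsWeakUpperGradient μ p Ω (fun x => (u x + v x) / 2)
        (fun x => 2⁻¹ * (minGrad μ p Ω u x + minGrad μ p Ω v x)) :=
      hgu.1.combine hp0 hgv.1 ((hgu.1.1.add hgv.1.1).const_mul _) fun γ => UGIneq.half_add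
    have hmidp : ∫⁻ x in Ω, (2⁻¹ * (minGrad μ p Ω u x + minGrad μ p Ω v x)) ^ p ∂μ < ∞ := by
      refine (lintegral_mono fun x => ENNReal.rpow_le_rpow ?_ hp0.le).trans_lt
        (lintegral_max_rpow_lt_top hgu.1.1 hgu.2.1 hgv.2.1)
      calc 2⁻¹ * (minGrad μ p Ω u x + minGrad μ p Ω v x)
          ≤ 2⁻¹ * (max (minGrad μ p Ω u x) (minGrad μ p Ω v x) +
              max (minGrad μ p Ω u x) (minGrad μ p Ω v x)) := by
            gcongr
            · exact le_max_left _ _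
            · exact le_max_right _ _
        _ = _ := by
            rw [← two_mul, ← mul_assoc, ENNReal.inv_mul_cancel two_ne_zero ENNReal.ofNat_ne_top,
              one_mul]
    refine ae_eq_of_lintegral_rpow_half_add hp hgu.1.1 hgv.1.1 hgu.2.1 hgv.2.1 ?_
    -- The minimal gradient of the midpoint is at most the half sum, so it suffices that its energy
    -- is at least the mean energy. This follows from minimality of u, the boundary term being
    -- affine here.
    refine le_trans ?_ (lintegral_mono_ae ((hgw.2.2 _ hmid hmidp).mono fun x hx =>
      ENNReal.rpow_le_rpow hx hp0.le))
    have hu2 := hgu.2.1.ne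
    have hv2 := hgv.2.1.ne
    rw [← ENNReal.toReal_le_toReal (by finiteness) hgw.2.1.ne,
      ENNReal.toReal_add (by finiteness) (by finiteness), ENNReal.toReal_mul, ENNReal.toReal_mul,
      ENNReal.toReal_inv, ENNReal.toReal_ofNat]
    simp only [neumannFunctional, hbw] at hle huv
    linarith
  have henergy : ∫⁻ x in Ω, minGrad μ p Ω u x ^ p ∂μ = ∫⁻ x in Ω, minGrad μ p Ω v x ^ p ∂μ :=
    lintegral_congr_ae (hgrad.mono fun x hx => by simp only [hx])
  have hb : boundaryTerm μ Ω f u = boundaryTerm μ Ω f v := by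
    simpa only [neumannFunctional, henergy, add_right_inj] using huv
  -- Since g_u = g_v a.e., the weak upper gradient max(g_u, g_v) of F(u, v) is just g_u.
  have hcomb : ∀ F : ℝ × ℝ → ℝ, LipschitzWith 1 F →
      (∫⁻ x in Ω, minGrad μ p Ω (fun x => F (u x, v x)) x ^ p ∂μ).toReal ≤
        (∫⁻ x in Ω, minGrad μ p Ω u x ^ p ∂μ).toReal := fun F hF => by
    have hgw := Newtonian.isMinimalWeakUpperGradient_minGrad hp0
      (Newtonian.comp_lipschitz hμΩ hF huN hvN)
    refine ENNReal.toReal_mono hgu.2.1.ne (lintegral_mono_ae ?_)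
    filter_upwards [hgrad, hgw.2.2 _ (hgu.1.combine hp0 hgv.1 (hgu.1.1.max hgv.1.1)
      fun γ => UGIneq.comp_lipschitz hF) (lintegral_max_rpow_lt_top hgu.1.1 hgu.2.1 hgv.2.1)]
      with x h1 h2
    rw [← h1, max_self] at h2
    exact ENNReal.rpow_le_rpow h2 hp0.le
  -- The normalizing constant c drops out because f has integral zero.
  have hbc : ∀ (S : ℝ × ℝ → ℝ) (c : ℝ), LipschitzWith 1 (fun q => S q - c) →
      IntegrableOn (fun x => S (trace μ Ω u x, trace μ Ω v x)) (frontier Ω)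
        (perimeterMeasure μ Ω) →
      boundaryTerm μ Ω f (fun x => S (u x, v x) - c) =
        ∫ x in frontier Ω, S (trace μ Ω u x, trace μ Ω v x) * f x ∂(perimeterMeasure μ Ω) := by
    intro S c hS hSi
    calc boundaryTerm μ Ω f (fun x => S (u x, v x) - c)
        = ∫ x in frontier Ω, (S (trace μ Ω u x, trace μ Ω v x) * f x - c * f x)
            ∂(perimeterMeasure μ Ω) := by
          refine integral_congr_ae ?_
          filter_upwards [hΩ.trace_comp_lipschitz hp hμ hS huN hvN] with x hx
          rw [hx]
          ring
      _ = _ := by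
          rw [integral_sub (hf.integrableOn_mul hSi) (hf1.const_mul c), integral_const_mul,
            hf.integral_eq_zero, mul_zero, sub_zero]
  set c₁ := ⨍ y in Ω, max (u y) (v y) ∂μ
  set c₂ := ⨍ y in Ω, min (u y) (v y) ∂μ
  have hmaxi : IntegrableOn (fun x => max (trace μ Ω u x) (trace μ Ω v x)) (frontier Ω)
    (perimeterMeasure μ Ω) := Integrable.sup hTu hTv
  have hmini : IntegrableOn (fun x => min (trace μ Ω u x) (trace μ Ω v x)) (frontier Ω)
    (perimeterMeasure μ Ω) := Integrable.inf hTu hTv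
  have hmax : (fun x => max (u x) (v x) - c₁) ∈ NewtonianZero μ p Ω :=
    ⟨Newtonian.comp_lipschitz hμΩ (lipschitzWith_max_sub c₁) huN hvN, integral_sub_average _ _⟩
  have hmin : (fun x => min (u x) (v x) - c₂) ∈ NewtonianZero μ p Ω :=
    ⟨Newtonian.comp_lipschitz hμΩ (lipschitzWith_min_sub c₂) huN hvN, integral_sub_average _ _⟩
  have hbsum : boundaryTerm μ Ω f (fun x => max (u x) (v x) - c₁) +
      boundaryTerm μ Ω f (fun x => min (u x) (v x) - c₂) =
      boundaryTerm μ Ω f u + boundaryTerm μ Ω f v := by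
    rw [hbc (fun q => max q.1 q.2) c₁ (lipschitzWith_max_sub c₁) hmaxi,
      hbc (fun q => min q.1 q.2) c₂ (lipschitzWith_min_sub c₂) hmini,
      ← integral_add (hf.integrableOn_mul hmaxi) (hf.integrableOn_mul hmini),
      boundaryTerm, boundaryTerm, ← integral_add hTuf hTvf]
    simp only [← add_mul, max_add_min]
  have hE₁ := hcomb _ (lipschitzWith_max_sub c₁)
  have hE₂ := hcomb _ (lipschitzWith_min_sub c₂)
  have hI₁ := humin _ hmax
  have hI₂ := humin _ hmin
  -- The lower bound I(u) for one of the two functions, its energy bound and the sum of the boundary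
  -- terms bound the boundary term of the other by that of u.
  refine ⟨⟨hTuf, hTvf, hb⟩, ⟨hgu, hgv, hgrad⟩, ⟨hmax, fun w hw => le_trans ?_ (humin w hw)⟩,
    ⟨hmin, fun w hw => le_trans ?_ (humin w hw)⟩⟩ <;>
  · simp only [neumannFunctional] at hI₁ hI₂ ⊢
    linarith
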